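/- **Lemma.** Write $U(N)$ for the group of $N\times N$ unitary matrices and $\overline{\mathrm{tr}}(X)=\frac1N\mathrm{tr}(X)$ for the normalized trace. A *$T$-query quantum algorithm* with black box $X\in U(N)$ acts on $\mathbb C^N\otimes\mathbb C^d$ for some finite $d$, starting from some density operator. It makes at most $T$ queries; each query applies $X$ or $X^\dagger$ to the register $\mathbb C^N$, possibly controlled on the workspace $\mathbb C^d$. Between queries it performs arbitrary quantum measurements/operations (with Kraus operators $K_i$, $\sum_i K_i^\dagger K_i=1$), on whose classical outcomes all later steps, including whether the next query is to $X$ or to $X^\dagger$, may depend. At the end it accepts or rejects by a two-outcome measurement. Let $\Pr[\mathcal A(X)=1]$ be its acceptance probability. Let $Z,Y\in U(N)$ be diagonal unitary matrices, let $U,V\in U(N)$ be Haar random, and let $M$ and $W$ be random unitaries distributed as $$M\sim UZU^\dagger,\qquad W\sim VYV^\dagger .$$ Assume that $\overline{\mathrm{tr}}(Z^k)=0$ for all integers $1\le k\le T$ with $k<N$, and put $\vec\alpha_T=(\alpha_1,\dots,\alpha_T)$ with $\alpha_k=\overline{\mathrm{tr}}(Y^k)$. Then no $T$-query quantum algorithm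 distinguishes $W$ from $M$ with advantage greater than $16\,\|\vec\alpha_T\|_1\,T^{7/2}$: for every $T$-query quantum algorithm $\mathcal A$, $$\Bigl|\;\mathbb E_W\Pr[\mathcal A(W)=1]-\mathbb E_M\Pr[\mathcal A(M)=1]\;\Bigr|\;\le\;16\,\|\vec\alpha_T\|_1\,T^{7/2},\qquad \|\vec\alpha_T\|_1=\sum_{k=1}^T|\alpha_k| .$$ -/

import Mathlib

open MeasureTheory ProbabilityTheory
open scoped Matrix ComplexOrder

/-- The unitary group `U(N)`. -/
abbrev UGroup (N : ℕ) : Type := Matrix.unitaryGroup (Fin N) ℂ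

theorem isCompact_unitaryGroup (N : ℕ) :
    IsCompact (Matrix.unitaryGroup (Fin N) ℂ : Set (Matrix (Fin N) (Fin N) ℂ)) := by
  have hK : IsCompact (Set.pi Set.univ fun _ : Fin N =>
      Set.pi Set.univ fun _ : Fin N => Metric.closedBall (0 : ℂ) 1) :=
    isCompact_univ_pi fun _ => isCompact_univ_pi fun _ => isCompact_closedBall 0 1
  refine IsCompact.of_isClosed_subset hK isClosed_unitary ?_
  intro A hA i _ j _
  simpa using entry_norm_bound_of_unitary hA i j

instance instCompactSpaceUGroup (N : ℕ) : CompactSpace (UGroup N) :=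
  isCompact_iff_compactSpace.mp (isCompact_unitaryGroup N)

noncomputable instance instMeasurableSpaceUGroup (N : ℕ) : MeasurableSpace (UGroup N) := borel _

instance instBorelSpaceUGroup (N : ℕ) : BorelSpace (UGroup N) := ⟨rfl⟩

/-- The Haar probability measure on `U(N)`. -/
noncomputable def haarUnitary (N : ℕ) : Measure (UGroup N) := Measure.haarMeasure ⊤

/-- The law of `U D U†`, where `D` is a fixed unitary and `U` is Haar random. -/
noncomputable def haarConjLaw {N : ℕ} (D : UGroup N) : Measure (UGroup N) :=
  (haarUnitary N).map fun U => U * D * U⁻¹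

/-- The normalized trace moment `tr(X ^ k) / N`. -/
noncomputable def traceMoment {N : ℕ} (X : UGroup N) (k : ℕ) : ℂ :=
  Matrix.trace ((X : Matrix (Fin N) (Fin N) ℂ) ^ k) / N

/-- The `ℓ¹` norm of the vector of the first `T` normalized trace moments. -/
noncomputable def momentNorm {N : ℕ} (X : UGroup N) (T : ℕ) : ℝ :=
  ∑ k ∈ Finset.Icc 1 T, ‖traceMoment X k‖

/-- Operators on `ℂ^N ⊗ ℂ^d`: the query register tensored with a workspace of dimension `d`. -/
abbrev Op (N d : ℕ) : Type := Matrix (Fin N × Fin d) (Fin N × Fin d) ℂ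

/-- One query to `X` (or to `X†`, if `adj` is true) on `ℂ^N ⊗ ℂ^d`. It is applied to the query
register when the workspace is in a basis state `a` with `ctl a = true`, and the identity is applied
otherwise. With `ctl` constantly true this is the plain query `X ⊗ 1` (or `X† ⊗ 1`). -/
def queryOp {N d : ℕ} (X : UGroup N) (adj : Bool) (ctl : Fin d → Bool) : Op N d :=
  Matrix.blockDiagonal fun a =>
    if ctl a then
      (if adj then (X : Matrix (Fin N) (Fin N) ℂ)ᴴ else (X : Matrix (Fin N) (Fin N) ℂ))
    else 1

/-- Adaptive procedures making at most `T` queries.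
* `halt E`: measure the effect `0 ≤ E ≤ 1` and accept if it occurs.
* `query m K adj ctl next`: perform the measurement with Kraus operators `K 0, …, K (m - 1)`; on
  outcome `i`, query the black box (or its adjoint, according to `adj i`) with control `ctl i`, and
  continue with the procedure `next i`.

Unitaries, arbitrary channels, and arbitrary quantum instruments are special cases of the
measurement step. -/
inductive QueryProc (N d : ℕ) : ℕ → Type where
  | halt {T : ℕ} (E : Op N d) (nonneg : E.PosSemidef) (le_one : (1 - E).PosSemidef) :
      QueryProc N d T
  | query {T : ℕ} (m : ℕ) (K : Fin m → Op N d) (complete : ∑ i, (K i)ᴴ * K i = 1)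
      (adj : Fin m → Bool) (ctl : Fin m → Fin d → Bool) (next : Fin m → QueryProc N d T) :
      QueryProc N d (T + 1)

/-- The probability that the procedure accepts, when it is run with black box `X` from the
state `ρ` (for unnormalized `ρ`: the joint weight of being in this branch and accepting). -/
noncomputable def QueryProc.acceptWeight {N d : ℕ} (X : UGroup N) :
    {T : ℕ} → QueryProc N d T → Op N d → ℝ
  | _, .halt E _ _, ρ => (E * ρ).trace.re
  | _, .query _ K _ adj ctl next, ρ =>
      ∑ i, (next i).acceptWeight X
        (queryOp X (adj i) (ctl i) * (K i * ρ * (K i)ᴴ) * (queryOp X (adj i) (ctl i))ᴴ)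

/-- A `T`-query quantum decision algorithm for a black-box unitary in `U(N)`: a workspace dimension,
an initial density operator, and an adaptive procedure making at most `T` queries. -/
structure QueryAlgorithm (N T : ℕ) where
  d : ℕ
  init : Op N d
  init_nonneg : init.PosSemidef
  init_trace : init.trace = 1
  proc : QueryProc N d T

/-- The acceptance probability of the algorithm on the black box `X`. -/
noncomputable def QueryAlgorithm.acceptProb {N T : ℕ} (A : QueryAlgorithm N T) (X : UGroup N) : ℝ :=
  A.proc.acceptWeight X A.init

/-! For fixed `U`, the acceptance probability on `U diag(δ) U†` is a polynomial of degree at most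
`T` in the `δ j` and at most `T` in their conjugates, because each query multiplies the state by the
black box on one side and by its adjoint on the other. Haar averaging makes it symmetric in the
eigenvalues. On the circle, a symmetric polynomial of this bidegree depends only on the first `T`
power sums, so either spectrum may be replaced by any other with the same first `T` moments
(`conjAvg_acceptProb_eq`).

It remains to find spectra `z`, with the moments of `Y`, and `w`, with vanishing moments, that are
close pointwise (`exists_hasNearbyConfig`). Newton's identities turn small power sums into small
coefficients. A self-inversive polynomial `x^M + … + c`, `|c| = 1`, with small middle coefficients
has its roots on the circle near those of `x^M + c` (`exists_roots_near_equally_spaced`). With `s =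
‖α‖₁` the distance is at most `π T s`; large `N` is cut into blocks of size `O(T)`, so that `N` does
not enter.

A hybrid argument (`abs_acceptProb_sub_le`) charges `3ε` per query to an eigenvalue shift of size
`ε`, for a total of `3π T² s`, which is below the claimed bound. If that bound is at least `1` there
is nothing to prove; otherwise Turán's bound forces `T < N`. -/

/-! ### Sums over permutations and power sums -/

/-- The sum over injective maps of a product of values is determined by the power sums of the
products over nonempty sets of factors. -/
theorem sum_embedding_prod_eq {J : Type*} [Fintype J] (ι : Type) [Fintype ι]
    (H H' : ι → J → ℂ)
    (h : ∀ B : Finset ι, B.Nonempty → ∑ j, ∏ i ∈ B, H i j = ∑ j, ∏ i ∈ B, H' i j) :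
    ∑ f : ι ↪ J, ∏ i, H i (f i) = ∑ f : ι ↪ J, ∏ i, H' i (f i) := by
  classical
  revert H H' h
  refine Fintype.induction_empty_option (P := fun ι _ => ∀ H H' : ι → J → ℂ,
    (∀ B : Finset ι, B.Nonempty → ∑ j, ∏ i ∈ B, H i j = ∑ j, ∏ i ∈ B, H' i j) →
    ∑ f : ι ↪ J, ∏ i, H i (f i) = ∑ f : ι ↪ J, ∏ i, H' i (f i)) ?_ ?_ ?_ ι
  · intro α β _ e ih H H' h
    let := Fintype.ofEquiv β e.symm
    have key (G : β → J → ℂ) : ∑ f : β ↪ J, ∏ i, G i (f i) =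
        ∑ f : α ↪ J, ∏ i, G (e i) (f i) := by
      refine (Fintype.sum_equiv (e.embeddingCongr (Equiv.refl J)) _ _ fun f => ?_).symm
      rw [← e.prod_comp]
      simp
    rw [key, key]
    refine ih _ _ fun B hB => ?_
    have := h (B.map e.toEmbedding) (by simpa using hB)
    simpa using this
  · intro H H' _
    simp
  · intro α _ ih H H' h
    -- Inclusion–exclusion on the image of `none`: let it range freely, then subtract the collisions
    -- with each `i₀`. A collision merges the factor of `none` into that of `i₀`, leaving one factor
    -- fewer.
    have key (G : Option α → J → ℂ) : ∑ f : Option α ↪ J, ∏ i, G i (f i) =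
        (∑ j, G none j) * ∑ f : α ↪ J, ∏ i, G (some i) (f i) -
          ∑ i₀, ∑ f : α ↪ J, ∏ i, (if i = i₀ then fun j => G (some i) j * G none j
            else G (some i)) (f i) := by
      have h1 : ∑ f : Option α ↪ J, ∏ i, G i (f i) =
          ∑ f : α ↪ J, ∑ j : ((Set.range f)ᶜ : Set J), G none j * ∏ i, G (some i) (f i) := by
        rw [← Fintype.sum_sigma']
        refine Fintype.sum_equiv (Function.Embedding.optionEmbeddingEquiv α J) _ _ fun f => ?_
        rw [Fintype.prod_option]
        simp [Function.Embedding.optionEmbeddingEquiv]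
      have h2 (f : α ↪ J) : ∑ j : ((Set.range f)ᶜ : Set J), G none j =
          ∑ j, G none j - ∑ i, G none (f i) := by
        have e1 : ∑ j : ((Set.range f)ᶜ : Set J), G none j =
            ∑ j ∈ (Finset.univ.map f)ᶜ, G none j := by
          refine (Finset.sum_subtype _ (fun x => ?_) _).symm
          simp
        rw [e1, eq_sub_iff_add_eq, ← Finset.sum_map Finset.univ f (G none),
          Finset.sum_compl_add_sum]
      rw [h1, Finset.sum_comm (γ := α)]
      simp_rw [← Finset.sum_mul, h2, sub_mul, Finset.sum_sub_distrib, ← Finset.mul_sum]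
      congr 1
      refine Finset.sum_congr rfl fun f _ => ?_
      rw [Finset.sum_mul]
      refine Finset.sum_congr rfl fun i₀ _ => ?_
      rw [← Finset.mul_prod_erase Finset.univ _ (Finset.mem_univ i₀),
        ← Finset.mul_prod_erase Finset.univ _ (Finset.mem_univ i₀), if_pos rfl,
        ← mul_assoc, mul_comm (G none _)]
      congr 1
      refine Finset.prod_congr rfl fun i hi => ?_
      rw [if_neg (Finset.ne_of_mem_erase hi)]
    rw [key, key]
    have h0 := h {none} (by simp)
    simp only [Finset.prod_singleton] at h0
    rw [h0]
    congr 1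
    · congr 1
      refine ih _ _ fun B hB => ?_
      have := h (B.map .some) (by simpa using hB)
      simpa using this
    · refine Finset.sum_congr rfl fun i₀ _ => ih _ _ fun B hB => ?_
      -- A power sum of the merged family is a power sum of the original one, with `none` adjoined
      -- to `B` exactly when `i₀ ∈ B`.
      have aux (G : Option α → J → ℂ) (j : J) : ∏ i ∈ B, (if i = i₀ then
          fun j => G (some i) j * G none j else G (some i)) j =
          ∏ i ∈ (if i₀ ∈ B then B.insertNone else B.map .some), G i j := by
        split_ifs with hi
        · rw [Finset.prod_insertNone, ← Finset.mul_prod_erase B _ hi,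
            ← Finset.mul_prod_erase B (fun i => G (some i) j) hi, if_pos rfl,
            mul_comm (G (some i₀) j), mul_assoc]
          congr 2
          refine Finset.prod_congr rfl fun i hi => ?_
          rw [if_neg (Finset.ne_of_mem_erase hi)]
        · rw [Finset.prod_map]
          refine Finset.prod_congr rfl fun i hi' => ?_
          rw [if_neg (fun hh : i = i₀ => hi (hh ▸ hi'))]
          rfl
      simp_rw [aux]
      refine h _ ?_
      split_ifs
      · exact ⟨none, by simp⟩
      · simpa using hB

theorem sum_perm_prod_eq {n : ℕ} (H H' : Fin n → Fin n → ℂ)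
    (h : ∀ B : Finset (Fin n), B.Nonempty → ∑ j, ∏ i ∈ B, H i j = ∑ j, ∏ i ∈ B, H' i j) :
    ∑ σ : Equiv.Perm (Fin n), ∏ i, H i (σ i) = ∑ σ : Equiv.Perm (Fin n), ∏ i, H' i (σ i) := by
  have key (G : Fin n → Fin n → ℂ) : ∑ σ : Equiv.Perm (Fin n), ∏ i, G i (σ i) =
      ∑ f : Fin n ↪ Fin n, ∏ i, G i (f i) :=
    (Fintype.sum_equiv (Equiv.embeddingEquivOfFinite (Fin n)) _ _ fun f =>
      Finset.prod_congr rfl fun i _ => rfl).symm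
  rw [key, key, sum_embedding_prod_eq (Fin n) H H' h]

/-! ### Polynomials in the eigenvalues and their conjugates -/

/-- The span of the monomials of degree at most `a` in the coordinates and at most `b` in their
conjugates, as functions on the torus. -/
def torusPoly (N a b : ℕ) : Submodule ℂ ((Fin N → Circle) → ℂ) :=
  Submodule.span ℂ {F | ∃ u v : Fin N → ℕ, ∑ j, u j ≤ a ∧ ∑ j, v j ≤ b ∧
    F = fun δ => ∏ j, ((δ j : ℂ) ^ u j * star (δ j : ℂ) ^ v j)}

theorem torusPoly_mul {N a b a' b' : ℕ} {F G : (Fin N → Circle) → ℂ}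
    (hF : F ∈ torusPoly N a b) (hG : G ∈ torusPoly N a' b') :
    (fun δ => F δ * G δ) ∈ torusPoly N (a + a') (b + b') := by
  have h := Submodule.mul_mem_mul hF hG
  rw [torusPoly, torusPoly, Submodule.span_mul_span] at h
  refine Submodule.span_mono ?_ h
  rintro _ ⟨_, ⟨u, v, hu, hv, rfl⟩, _, ⟨u', v', hu', hv', rfl⟩, rfl⟩
  refine ⟨u + u', v + v', ?_, ?_, ?_⟩
  · simp only [Pi.add_apply, Finset.sum_add_distrib]; omega
  · simp only [Pi.add_apply, Finset.sum_add_distrib]; omega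
  · funext δ
    simp only [Pi.mul_apply, ← Finset.prod_mul_distrib, Pi.add_apply]
    exact Finset.prod_congr rfl fun j _ => by ring

theorem torusPoly_mono {N a b a' b' : ℕ} (ha : a ≤ a') (hb : b ≤ b') :
    torusPoly N a b ≤ torusPoly N a' b' := by
  refine Submodule.span_mono ?_
  rintro _ ⟨u, v, hu, hv, rfl⟩
  exact ⟨u, v, hu.trans ha, hv.trans hb, rfl⟩

theorem torusPoly_const {N : ℕ} (a b : ℕ) (c : ℂ) : (fun _ => c) ∈ torusPoly N a b := by
  have : (fun _ => c : (Fin N → Circle) → ℂ) = c • fun _ => 1 := by funext; simp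
  rw [this]
  refine Submodule.smul_mem _ _ (Submodule.subset_span ⟨0, 0, by simp, by simp, ?_⟩)
  funext; simp

theorem torusPoly_coord {N : ℕ} (l : Fin N) : (fun δ => (δ l : ℂ)) ∈ torusPoly N 1 0 := by
  refine Submodule.subset_span ⟨Pi.single l 1, 0, by simp, by simp, ?_⟩
  funext δ
  rw [Finset.prod_eq_single l] <;> simp +contextual

theorem torusPoly_star {N a b : ℕ} {F : (Fin N → Circle) → ℂ} (hF : F ∈ torusPoly N a b) :
    (fun δ => star (F δ)) ∈ torusPoly N b a := by
  induction hF using Submodule.span_induction with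
  | mem F hF =>
    obtain ⟨u, v, hu, hv, rfl⟩ := hF
    refine Submodule.subset_span ⟨v, u, hv, hu, ?_⟩
    funext δ
    rw [star_prod]
    exact Finset.prod_congr rfl fun j _ => by simp [mul_comm]
  | zero =>
    convert Submodule.zero_mem (torusPoly N b a)
    simp
  | add F G _ _ hF hG =>
    convert Submodule.add_mem _ hF hG using 1
    funext δ
    simp
  | smul c F _ hF =>
    convert Submodule.smul_mem _ (star c) hF using 1
    funext δ
    simp

theorem torusPoly_sum {N a b : ℕ} {ι : Type*} (s : Finset ι) (F : ι → (Fin N → Circle) → ℂ)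
    (hF : ∀ i ∈ s, F i ∈ torusPoly N a b) : (fun δ => ∑ i ∈ s, F i δ) ∈ torusPoly N a b := by
  have := Submodule.sum_mem _ hF
  convert this using 1
  funext δ
  simp

theorem torusPoly_re {N a : ℕ} {F : (Fin N → Circle) → ℂ} (hF : F ∈ torusPoly N a a) :
    (fun δ => ((F δ).re : ℂ)) ∈ torusPoly N a a := by
  have := Submodule.smul_mem _ (1 / 2 : ℂ) (Submodule.add_mem _ hF (torusPoly_star hF))
  convert this using 1
  funext δ
  simp [Complex.re_eq_add_conj]
  ring

/-- Conjugation is inversion on the circle, so each mixed monomial is a power of `z` or of its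
conjugate with exponent `|u - v| ≤ T`. -/
theorem sum_conj_mul_pow {N T : ℕ} {δ δ' : Fin N → Circle}
    (h : ∀ k, 1 ≤ k → k ≤ T → ∑ j, (δ j : ℂ) ^ k = ∑ j, (δ' j : ℂ) ^ k) {u v : ℕ}
    (hu : u ≤ T) (hv : v ≤ T) :
    ∑ j, (δ j : ℂ) ^ u * star (δ j : ℂ) ^ v = ∑ j, (δ' j : ℂ) ^ u * star (δ' j : ℂ) ^ v := by
  have hz (z : Circle) : (z : ℂ) * star (z : ℂ) = 1 := by
    rw [Complex.star_def, Complex.mul_conj, Circle.normSq_coe]; simp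
  have hz' (z : Circle) : star (z : ℂ) * (z : ℂ) = 1 := by rw [mul_comm, hz]
  rcases lt_trichotomy u v with huv | rfl | huv
  · have (z : Circle) : (z : ℂ) ^ u * star (z : ℂ) ^ v = star ((z : ℂ) ^ (v - u)) := by
      obtain ⟨w, rfl⟩ := Nat.exists_eq_add_of_le huv.le
      rw [pow_add, ← mul_assoc, ← mul_pow, hz, one_pow, one_mul, star_pow,
        Nat.add_sub_cancel_left]
    simp_rw [this, ← star_sum]
    rw [h _ (by omega) (by omega)]
  · simp_rw [← mul_pow, hz]
  · have (z : Circle) : (z : ℂ) ^ u * star (z : ℂ) ^ v = (z : ℂ) ^ (u - v) := by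
      obtain ⟨w, rfl⟩ := Nat.exists_eq_add_of_le huv.le
      rw [mul_comm, pow_add, ← mul_assoc, ← mul_pow, hz', one_pow, one_mul,
        Nat.add_sub_cancel_left]
    simp_rw [this]
    rw [h _ (by omega) (by omega)]

/-- The symmetrization of a polynomial of bidegree at most `(T, T)` only depends on the first `T`
power sums. -/
theorem sum_perm_torusPoly_eq {N T : ℕ} {F : (Fin N → Circle) → ℂ} (hF : F ∈ torusPoly N T T)
    {δ δ' : Fin N → Circle}
    (h : ∀ k, 1 ≤ k → k ≤ T → ∑ j, (δ j : ℂ) ^ k = ∑ j, (δ' j : ℂ) ^ k) :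
    ∑ σ : Equiv.Perm (Fin N), F (δ ∘ σ) = ∑ σ : Equiv.Perm (Fin N), F (δ' ∘ σ) := by
  induction hF using Submodule.span_induction with
  | mem F hF =>
    obtain ⟨u, v, hu, hv, rfl⟩ := hF
    -- At permuted points a monomial is a product of one-variable factors. Multiplying the factors
    -- over `B` adds exponents, which stay at most `T` because the total degrees do.
    refine sum_perm_prod_eq (fun i j => (δ j : ℂ) ^ u i * star (δ j : ℂ) ^ v i)
      (fun i j => (δ' j : ℂ) ^ u i * star (δ' j : ℂ) ^ v i) fun B _ => ?_
    simp_rw [Finset.prod_mul_distrib, Finset.prod_pow_eq_pow_sum]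
    exact sum_conj_mul_pow h ((Finset.sum_le_sum_of_subset (Finset.subset_univ B)).trans hu)
      ((Finset.sum_le_sum_of_subset (Finset.subset_univ B)).trans hv)
  | zero => simp
  | add F G _ _ hF hG => simp [Finset.sum_add_distrib, hF, hG]
  | smul c F _ hF => simp [← Finset.mul_sum, hF]

/-! ### Acceptance probabilities as polynomials in the eigenvalues -/

/-- Matrix-valued functions on the torus whose entries lie in `torusPoly N a b`. -/
def TorusPolyMat {N : ℕ} (a b : ℕ) {m n : Type*} (R : (Fin N → Circle) → Matrix m n ℂ) : Prop :=
  ∀ i j, (fun δ => R δ i j) ∈ torusPoly N a b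

theorem TorusPolyMat.mul {N a b a' b' : ℕ} {m n p : Type*} [Fintype n]
    {R : (Fin N → Circle) → Matrix m n ℂ} {S : (Fin N → Circle) → Matrix n p ℂ}
    (hR : TorusPolyMat a b R) (hS : TorusPolyMat a' b' S) :
    TorusPolyMat (a + a') (b + b') fun δ => R δ * S δ := fun i j => by
  simp only [Matrix.mul_apply]
  exact torusPoly_sum _ (fun k δ => R δ i k * S δ k j) fun k _ => torusPoly_mul (hR i k) (hS k j)

theorem TorusPolyMat.conjTranspose {N a b : ℕ} {m n : Type*}
    {R : (Fin N → Circle) → Matrix m n ℂ} (hR : TorusPolyMat a b R) :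
    TorusPolyMat b a fun δ => (R δ)ᴴ := fun i j => torusPoly_star (hR j i)

theorem TorusPolyMat.const {N : ℕ} (a b : ℕ) {m n : Type*} (K : Matrix m n ℂ) :
    TorusPolyMat (N := N) a b fun _ => K := fun i j => torusPoly_const a b (K i j)

theorem TorusPolyMat.trace {N a b : ℕ} {m : Type*} [Fintype m]
    {R : (Fin N → Circle) → Matrix m m ℂ} (hR : TorusPolyMat a b R) :
    (fun δ => (R δ).trace) ∈ torusPoly N a b :=
  torusPoly_sum _ (fun i δ => R δ i i) fun i _ => hR i i

/-- The diagonal unitary matrix with the given diagonal entries. -/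
noncomputable def diagUnitary {N : ℕ} (δ : Fin N → Circle) : UGroup N :=
  ⟨Matrix.diagonal fun j => (δ j : ℂ), by
    rw [Matrix.mem_unitaryGroup_iff, Matrix.star_eq_conjTranspose, Matrix.diagonal_conjTranspose,
      Matrix.diagonal_mul_diagonal, ← Matrix.diagonal_one]
    congr 1
    funext j
    simp [Complex.mul_conj, Circle.normSq_coe]⟩

theorem coe_diagUnitary {N : ℕ} (δ : Fin N → Circle) :
    (diagUnitary δ : Matrix (Fin N) (Fin N) ℂ) = Matrix.diagonal fun j => (δ j : ℂ) := rfl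

theorem exists_eq_diagUnitary {N : ℕ} (X : UGroup N)
    (hX : (X : Matrix (Fin N) (Fin N) ℂ).IsDiag) : ∃ δ : Fin N → Circle, X = diagUnitary δ := by
  have h := Matrix.mem_unitaryGroup_iff.mp X.2
  have hd := (Matrix.isDiag_iff_diagonal_diag _).mp hX
  have hn (j : Fin N) : ‖(X : Matrix (Fin N) (Fin N) ℂ) j j‖ = 1 := by
    rw [← hd, Matrix.star_eq_conjTranspose, Matrix.diagonal_conjTranspose,
      Matrix.diagonal_mul_diagonal] at h
    have h1 := congrFun (congrFun h j) j
    simp only [Matrix.diagonal_apply_eq, Matrix.one_apply_eq, Matrix.diag_apply, Pi.star_apply,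
      Complex.star_def, Complex.mul_conj, Complex.normSq_eq_norm_sq] at h1
    have h2 : ‖(X : Matrix (Fin N) (Fin N) ℂ) j j‖ ^ 2 = 1 := by exact_mod_cast h1
    exact (pow_eq_one_iff_of_nonneg (norm_nonneg _) two_ne_zero).mp h2
  refine ⟨fun j => ⟨(X : Matrix (Fin N) (Fin N) ℂ) j j, mem_sphere_zero_iff_norm.mpr (hn j)⟩, ?_⟩
  exact Subtype.ext hd.symm

theorem traceMoment_diagUnitary {N : ℕ} (δ : Fin N → Circle) (k : ℕ) :
    traceMoment (diagUnitary δ) k = (∑ j, (δ j : ℂ) ^ k) / N := by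
  rw [traceMoment, coe_diagUnitary, Matrix.diagonal_pow, Matrix.trace_diagonal]
  rfl

theorem torusPolyMat_conj_diagUnitary {N : ℕ} (U : UGroup N) :
    TorusPolyMat 1 0 fun δ : Fin N → Circle =>
      ((U * diagUnitary δ * U⁻¹ : UGroup N) : Matrix (Fin N) (Fin N) ℂ) := by
  have h : TorusPolyMat 1 0 fun δ : Fin N → Circle => Matrix.diagonal fun j => (δ j : ℂ) := by
    intro i j
    by_cases hij : i = j
    · subst hij
      simpa using torusPoly_coord i
    · simpa [hij] using torusPoly_const 1 0 0
  have h2 := ((TorusPolyMat.const 0 0 (U : Matrix (Fin N) (Fin N) ℂ)).mul h).mul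
    (TorusPolyMat.const 0 0 (U : Matrix (Fin N) (Fin N) ℂ)ᴴ)
  simp only [zero_add, add_zero] at h2
  exact h2

theorem torusPolyMat_queryOp {N d : ℕ} {X : (Fin N → Circle) → UGroup N}
    (hX : TorusPolyMat 1 0 fun δ => (X δ : Matrix (Fin N) (Fin N) ℂ)) (adj : Bool)
    (ctl : Fin d → Bool) :
    ∃ a b, a + b = 1 ∧ TorusPolyMat a b fun δ => queryOp (X δ) adj ctl := by
  have h : ∃ a b, a + b = 1 ∧ TorusPolyMat a b fun δ => if adj then
      (X δ : Matrix (Fin N) (Fin N) ℂ)ᴴ else (X δ : Matrix (Fin N) (Fin N) ℂ) := by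
    cases adj
    · exact ⟨1, 0, rfl, by simpa using hX⟩
    · exact ⟨0, 1, rfl, by simpa using hX.conjTranspose⟩
  obtain ⟨a, b, hab, h⟩ := h
  refine ⟨a, b, hab, ?_⟩
  rintro ⟨i, p⟩ ⟨j, q⟩
  simp only [queryOp, Matrix.blockDiagonal_apply]
  by_cases hpq : p = q
  · by_cases hc : ctl p
    · simpa only [hpq, hc, if_true, hpq ▸ hc] using h i j
    · have hc' : ¬ ctl q := hpq ▸ hc
      simp only [hpq, hc', if_true]
      exact torusPoly_const a b ((1 : Matrix (Fin N) (Fin N) ℂ) i j)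
  · simpa only [hpq, if_false] using torusPoly_const a b _

/-- A query `Q` of bidegree `(a, b)` with `a + b = 1` acts by `Q · Q†`, so it adds `(1, 1)` whether
it is direct, adjoint or controlled; branching only adds up terms. The state may depend on `δ`
because it does so after the first query. -/
theorem acceptWeight_mem_torusPoly {N d T : ℕ} (proc : QueryProc N d T)
    {X : (Fin N → Circle) → UGroup N}
    (hX : TorusPolyMat 1 0 fun δ => (X δ : Matrix (Fin N) (Fin N) ℂ)) {s : ℕ}
    {ρ : (Fin N → Circle) → Op N d} (hρ : TorusPolyMat s s ρ) :
    (fun δ => (proc.acceptWeight (X δ) (ρ δ) : ℂ)) ∈ torusPoly N (s + T) (s + T) := by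
  induction proc generalizing s ρ with
  | halt E h0 h1 =>
    refine torusPoly_mono (Nat.le_add_right _ _) (Nat.le_add_right _ _)
      (torusPoly_re (TorusPolyMat.trace ?_))
    simpa using (TorusPolyMat.const 0 0 E).mul hρ
  | @query T m K hK adj ctl next ih =>
    simp only [QueryProc.acceptWeight, Complex.ofReal_sum]
    refine torusPoly_sum _ (fun i δ => ((next i).acceptWeight (X δ)
      (queryOp (X δ) (adj i) (ctl i) * (K i * ρ δ * (K i)ᴴ) *
        (queryOp (X δ) (adj i) (ctl i))ᴴ) : ℂ)) fun i _ => ?_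
    obtain ⟨a, b, hab, hQ⟩ := torusPolyMat_queryOp hX (adj i) (ctl i)
    have h := (hQ.mul (((TorusPolyMat.const 0 0 (K i)).mul hρ).mul
      (TorusPolyMat.const 0 0 (K i)ᴴ))).mul hQ.conjTranspose
    have e1 : a + (0 + s + 0) + b = s + 1 := by omega
    have e2 : b + (0 + s + 0) + a = s + 1 := by omega
    rw [e1, e2] at h
    have := ih i h
    rwa [add_assoc, add_comm 1 T] at this

/-! ### Averages over the Haar measure -/

theorem continuous_queryOp {N d : ℕ} (adj : Bool) (ctl : Fin d → Bool) :
    Continuous fun X : UGroup N => queryOp X adj ctl := by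
  unfold queryOp
  refine Continuous.matrix_blockDiagonal (continuous_pi fun a => ?_)
  cases ctl a <;> cases adj <;> simp <;> fun_prop

theorem continuous_acceptWeight {N d T : ℕ} (proc : QueryProc N d T) {ρ : UGroup N → Op N d}
    (hρ : Continuous ρ) : Continuous fun X => proc.acceptWeight X (ρ X) := by
  induction proc generalizing ρ with
  | halt E h0 h1 =>
    simp only [QueryProc.acceptWeight]
    exact Complex.continuous_re.comp (Continuous.matrix_trace (continuous_const.mul hρ))
  | query m K hK adj ctl next ih =>
    simp only [QueryProc.acceptWeight]
    refine continuous_finsetSum _ fun i _ => ih i ?_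
    have := continuous_queryOp (N := N) (adj i) (ctl i)
    exact (this.mul ((continuous_const.mul hρ).mul continuous_const)).mul
      this.matrix_conjTranspose

theorem continuous_acceptProb {N T : ℕ} (A : QueryAlgorithm N T) :
    Continuous fun X : UGroup N => A.acceptProb X :=
  continuous_acceptWeight A.proc continuous_const

instance instIsProbabilityMeasureHaarUnitary (N : ℕ) : IsProbabilityMeasure (haarUnitary N) :=
  ⟨by simpa [haarUnitary] using Measure.haarMeasure_self (G := UGroup N) (K₀ := ⊤)⟩

instance instIsMulLeftInvariantHaarUnitary (N : ℕ) : (haarUnitary N).IsMulLeftInvariant := by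
  unfold haarUnitary; infer_instance

/-- Compact groups are unimodular: a right translate of Haar measure is a multiple of it, and total
mass one fixes the factor. -/
instance instIsMulRightInvariantHaarUnitary (N : ℕ) : (haarUnitary N).IsMulRightInvariant := by
  refine ⟨fun g => ?_⟩
  have hp : IsProbabilityMeasure ((haarUnitary N).map (· * g)) :=
    Measure.isProbabilityMeasure_map (by fun_prop)
  have h := Measure.isMulInvariant_eq_smul_of_compactSpace ((haarUnitary N).map (· * g))
    (Measure.haarMeasure (⊤ : TopologicalSpace.PositiveCompacts (UGroup N)))
  change _ = _ • haarUnitary N at h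
  have h1 := congrArg (fun μ => μ Set.univ) h
  simp only [measure_univ, Measure.smul_apply] at h1
  rw [h]
  have h2 : ((Measure.haarScalarFactor ((haarUnitary N).map (· * g))
    (Measure.haarMeasure (⊤ : TopologicalSpace.PositiveCompacts (UGroup N)))) : ENNReal) = 1 := by
    simpa [ENNReal.smul_def] using h1.symm
  have h3 := ENNReal.coe_eq_one.mp h2
  rw [h3, one_smul]

/-- The average of a function over the conjugates of a unitary. -/
noncomputable def conjAvg {N : ℕ} (g : UGroup N → ℝ) (D : UGroup N) : ℝ :=
  ∫ U, g (U * D * U⁻¹) ∂haarUnitary N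

theorem integral_eq_conjAvg {N : ℕ} {D : UGroup N} {Ω : Type*} [MeasurableSpace Ω]
    {P : Measure Ω} {M : Ω → UGroup N} (hM : HasLaw M (haarConjLaw D) P) {g : UGroup N → ℝ}
    (hg : Continuous g) : ∫ ω, g (M ω) ∂P = conjAvg g D := by
  have h1 := hM.integral_comp (f := g) hg.aestronglyMeasurable
  have h2 : Measurable fun U : UGroup N => U * D * U⁻¹ := by
    have : Continuous fun U : UGroup N => U * D * U⁻¹ := by fun_prop
    exact this.measurable
  rw [haarConjLaw, integral_map h2.aemeasurable hg.aestronglyMeasurable] at h1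
  exact h1

theorem conjAvg_conj {N : ℕ} (g : UGroup N → ℝ) (D V : UGroup N) :
    conjAvg g (V * D * V⁻¹) = conjAvg g D := by
  unfold conjAvg
  rw [← integral_mul_right_eq_self (fun U => g (U * D * U⁻¹)) V]
  simp [mul_assoc]

theorem exists_diagUnitary_comp_perm {N : ℕ} (δ : Fin N → Circle) (σ : Equiv.Perm (Fin N)) :
    ∃ V : UGroup N, diagUnitary (δ ∘ σ) = V * diagUnitary δ * V⁻¹ := by
  have hV : σ.permMatrix ℂ ∈ Matrix.unitaryGroup (Fin N) ℂ := by
    rw [Matrix.mem_unitaryGroup_iff, Matrix.star_eq_conjTranspose, Matrix.conjTranspose_permMatrix,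
      ← Matrix.permMatrix_mul]
    simp
  refine ⟨⟨σ.permMatrix ℂ, hV⟩, ?_⟩
  apply Subtype.ext
  change Matrix.diagonal _ = σ.permMatrix ℂ * Matrix.diagonal _ * (σ.permMatrix ℂ)ᴴ
  rw [Matrix.conjTranspose_permMatrix]
  ext i j
  simp [Equiv.Perm.permMatrix, PEquiv.toMatrix_toPEquiv_mul, PEquiv.mul_toMatrix_toPEquiv,
    Matrix.diagonal_apply, Equiv.Perm.inv_def]

theorem integrable_acceptProb_conj {N T : ℕ} (A : QueryAlgorithm N T) (D : UGroup N) :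
    Integrable (fun U => A.acceptProb (U * D * U⁻¹)) (haarUnitary N) := by
  have hc : Continuous fun U : UGroup N => A.acceptProb (U * D * U⁻¹) :=
    (continuous_acceptProb A).comp (by fun_prop)
  exact hc.integrable_of_hasCompactSupport (HasCompactSupport.of_compactSpace _)

/-- Permuting the eigenvalues is conjugation by a permutation matrix, which the Haar average
absorbs. The average therefore equals its own symmetrization, and under the integral the symmetrized
polynomial sees only power sums. -/
theorem conjAvg_acceptProb_eq {N T : ℕ} (A : QueryAlgorithm N T) {δ δ' : Fin N → Circle}
    (h : ∀ k, 1 ≤ k → k ≤ T → ∑ j, (δ j : ℂ) ^ k = ∑ j, (δ' j : ℂ) ^ k) :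
    conjAvg A.acceptProb (diagUnitary δ) = conjAvg A.acceptProb (diagUnitary δ') := by
  have key (η : Fin N → Circle) : ∫ U, ∑ σ : Equiv.Perm (Fin N),
      A.acceptProb (U * diagUnitary (η ∘ σ) * U⁻¹) ∂haarUnitary N =
      Fintype.card (Equiv.Perm (Fin N)) * conjAvg A.acceptProb (diagUnitary η) := by
    rw [integral_finsetSum _ fun σ _ => integrable_acceptProb_conj A _]
    have (σ : Equiv.Perm (Fin N)) : ∫ U, A.acceptProb (U * diagUnitary (η ∘ σ) * U⁻¹)
        ∂haarUnitary N = conjAvg A.acceptProb (diagUnitary η) := by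
      obtain ⟨V, hV⟩ := exists_diagUnitary_comp_perm η σ
      rw [← conjAvg_conj _ _ V, ← hV]
      rfl
    simp [this]
  have hc : (Fintype.card (Equiv.Perm (Fin N)) : ℝ) ≠ 0 := by
    exact_mod_cast Fintype.card_ne_zero
  refine mul_left_cancel₀ hc ?_
  rw [← key, ← key]
  congr 1
  funext U
  have hF := acceptWeight_mem_torusPoly A.proc (torusPolyMat_conj_diagUnitary U)
    (TorusPolyMat.const 0 0 A.init)
  rw [zero_add] at hF
  have := sum_perm_torusPoly_eq hF h
  exact_mod_cast this

/-! ### Stability of acceptance probabilities under perturbation of the black box -/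

open scoped MatrixOrder in
theorem Matrix.PosSemidef.trace_mul_nonneg {n : Type*} [Fintype n] [DecidableEq n]
    {A B : Matrix n n ℂ} (hA : A.PosSemidef) (hB : B.PosSemidef) : 0 ≤ (A * B).trace := by
  obtain ⟨C, rfl⟩ := CStarAlgebra.nonneg_iff_eq_star_mul_self.mp hA.nonneg
  rw [mul_assoc, Matrix.trace_mul_comm, mul_assoc, ← mul_assoc, Matrix.star_eq_conjTranspose]
  exact (hB.mul_mul_conjTranspose_same C).trace_nonneg

theorem queryOp_conjTranspose_mul_self {N d : ℕ} (X : UGroup N) (adj : Bool) (ctl : Fin d → Bool) :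
    (queryOp X adj ctl)ᴴ * queryOp X adj ctl = 1 := by
  rw [queryOp, Matrix.blockDiagonal_conjTranspose, ← Matrix.blockDiagonal_mul,
    ← Matrix.blockDiagonal_one]
  congr 1
  funext a
  have h1 : (X : Matrix (Fin N) (Fin N) ℂ)ᴴ * X = 1 := Matrix.mem_unitaryGroup_iff'.mp X.2
  have h2 : (X : Matrix (Fin N) (Fin N) ℂ) * (X : Matrix (Fin N) (Fin N) ℂ)ᴴ = 1 :=
    Matrix.mem_unitaryGroup_iff.mp X.2
  cases ctl a <;> cases adj <;> simp [h1, h2]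

theorem trace_conj_of_conjTranspose_mul_self {n : Type*} [Fintype n] [DecidableEq n]
    {Q : Matrix n n ℂ} (hQ : Qᴴ * Q = 1) (ρ : Matrix n n ℂ) : (Q * ρ * Qᴴ).trace = ρ.trace := by
  rw [Matrix.trace_mul_comm, ← mul_assoc, hQ, one_mul]

theorem sum_trace_kraus {n : Type*} [Fintype n] [DecidableEq n] {m : ℕ}
    {K : Fin m → Matrix n n ℂ} (hK : ∑ i, (K i)ᴴ * K i = 1) (ρ : Matrix n n ℂ) :
    ∑ i, (K i * ρ * (K i)ᴴ).trace = ρ.trace := by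
  have (i : Fin m) : (K i * ρ * (K i)ᴴ).trace = ((K i)ᴴ * K i * ρ).trace := by
    rw [Matrix.trace_mul_comm, ← mul_assoc]
  simp_rw [this]
  rw [← Matrix.trace_sum, ← Finset.sum_mul, hK, one_mul]

namespace QueryProc

variable {N d : ℕ}

theorem acceptWeight_add (X : UGroup N) {T : ℕ} (proc : QueryProc N d T) (ρ σ : Op N d) :
    proc.acceptWeight X (ρ + σ) = proc.acceptWeight X ρ + proc.acceptWeight X σ := by
  induction proc generalizing ρ σ with
  | halt E h0 h1 => simp [acceptWeight, mul_add]
  | query m K hK adj ctl next ih => simp [acceptWeight, mul_add, add_mul, ih, Finset.sum_add_distrib]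

theorem acceptWeight_smul (X : UGroup N) {T : ℕ} (proc : QueryProc N d T) (c : ℝ) (ρ : Op N d) :
    proc.acceptWeight X (c • ρ) = c * proc.acceptWeight X ρ := by
  induction proc generalizing ρ with
  | halt E h0 h1 => simp [acceptWeight]
  | query m K hK adj ctl next ih => simp [acceptWeight, ih, Finset.mul_sum]

theorem acceptWeight_nonneg (X : UGroup N) {T : ℕ} (proc : QueryProc N d T) {ρ : Op N d}
    (hρ : ρ.PosSemidef) : 0 ≤ proc.acceptWeight X ρ := by
  induction proc generalizing ρ with
  | halt E h0 h1 => exact (Complex.le_def.mp (h0.trace_mul_nonneg hρ)).1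
  | query m K hK adj ctl next ih =>
    exact Finset.sum_nonneg fun i _ => ih i
      ((hρ.mul_mul_conjTranspose_same (K i)).mul_mul_conjTranspose_same _)

theorem acceptWeight_le_trace (X : UGroup N) {T : ℕ} (proc : QueryProc N d T) {ρ : Op N d}
    (hρ : ρ.PosSemidef) : proc.acceptWeight X ρ ≤ ρ.trace.re := by
  induction proc generalizing ρ with
  | halt E h0 h1 =>
    have := (Complex.le_def.mp (h1.trace_mul_nonneg hρ)).1
    simp only [sub_mul, one_mul, Matrix.trace_sub, Complex.sub_re, Complex.zero_re] at this
    simp only [acceptWeight]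
    linarith
  | query m K hK adj ctl next ih =>
    rw [← sum_trace_kraus hK ρ, Complex.re_sum]
    refine Finset.sum_le_sum fun i _ => ?_
    refine (ih i ((hρ.mul_mul_conjTranspose_same (K i)).mul_mul_conjTranspose_same _)).trans_eq ?_
    rw [trace_conj_of_conjTranspose_mul_self (queryOp_conjTranspose_mul_self _ _ _)]

end QueryProc

/-- The eigenvalues of a query to `U diag(δ) U†`. -/
noncomputable def queryEigenvalue {N d : ℕ} (δ : Fin N → Circle) (adj : Bool) (ctl : Fin d → Bool)
    (p : Fin N × Fin d) : ℂ :=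
  if ctl p.2 then (if adj then star (δ p.1 : ℂ) else (δ p.1 : ℂ)) else 1

/-- The diagonalizing unitary does not depend on `δ`, so the difference of two queries is diagonal
in the same basis and is controlled by eigenvalue differences alone. -/
theorem queryOp_conj_diagUnitary {N d : ℕ} (U : UGroup N) (δ : Fin N → Circle) (adj : Bool)
    (ctl : Fin d → Bool) :
    queryOp (U * diagUnitary δ * U⁻¹) adj ctl = queryOp U false (fun _ => true) *
      Matrix.diagonal (queryEigenvalue δ adj ctl) * (queryOp U false fun _ : Fin d => true)ᴴ := by
  have h2 : (U : Matrix (Fin N) (Fin N) ℂ) * (U : Matrix (Fin N) (Fin N) ℂ)ᴴ = 1 :=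
    Matrix.mem_unitaryGroup_iff.mp U.2
  have h3 : Matrix.diagonal (queryEigenvalue δ adj ctl) = Matrix.blockDiagonal fun a =>
      Matrix.diagonal fun j => queryEigenvalue δ adj ctl (j, a) := by
    rw [Matrix.blockDiagonal_diagonal]
  have h4 : ((U * diagUnitary δ * U⁻¹ : UGroup N) : Matrix (Fin N) (Fin N) ℂ) =
    U * Matrix.diagonal (fun j => (δ j : ℂ)) * (U : Matrix (Fin N) (Fin N) ℂ)ᴴ := rfl
  rw [h3]
  unfold queryOp
  rw [Matrix.blockDiagonal_conjTranspose, ← Matrix.blockDiagonal_mul, ← Matrix.blockDiagonal_mul,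
    h4]
  congr 1
  funext a
  simp only [queryEigenvalue]
  cases ctl a <;> cases adj <;>
    simp [h2, Matrix.conjTranspose_mul, mul_assoc, Matrix.diagonal_conjTranspose, Pi.star_def]

theorem norm_queryEigenvalue_sub_le {N d : ℕ} {δ δ' : Fin N → Circle} {ε : ℝ} (hε : 0 ≤ ε)
    (h : ∀ j, ‖(δ j : ℂ) - δ' j‖ ≤ ε) (adj : Bool) (ctl : Fin d → Bool) (p : Fin N × Fin d) :
    ‖queryEigenvalue δ adj ctl p - queryEigenvalue δ' adj ctl p‖ ≤ ε := by
  unfold queryEigenvalue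
  cases ctl p.2 <;> cases adj <;> simp only [if_true, if_false, Bool.false_eq_true]
  · simpa
  · simpa
  · exact h _
  · rw [← star_sub, norm_star]
    exact h _

/-- In the eigenbasis, conjugation by the diagonal matrix multiplies the `i`-th diagonal entry of
the state by `‖e i‖ ^ 2`, and these entries are nonnegative. -/
theorem trace_conj_diagonal_le {n : Type*} [Fintype n] [DecidableEq n] {V : Matrix n n ℂ}
    (hV : Vᴴ * V = 1) {e : n → ℂ} {ε : ℝ} (he : ∀ i, ‖e i‖ ≤ ε) {σ : Matrix n n ℂ}
    (hσ : σ.PosSemidef) :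
    ((V * Matrix.diagonal e * Vᴴ) * σ * (V * Matrix.diagonal e * Vᴴ)ᴴ).trace.re ≤
      ε ^ 2 * σ.trace.re := by
  have hV' : V * Vᴴ = 1 := mul_eq_one_comm.mp hV
  set τ := Vᴴ * σ * V with hτ
  have hpos : τ.PosSemidef := hσ.conjTranspose_mul_mul_same V
  have htr : σ.trace = τ.trace := by
    rw [hτ, Matrix.trace_mul_comm, ← mul_assoc, hV', one_mul]
  have h1 : (V * Matrix.diagonal e * Vᴴ) * σ * (V * Matrix.diagonal e * Vᴴ)ᴴ =
      V * (Matrix.diagonal e * τ * (Matrix.diagonal e)ᴴ) * Vᴴ := by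
    simp only [hτ, Matrix.conjTranspose_mul, Matrix.conjTranspose_conjTranspose, mul_assoc]
  rw [h1, trace_conj_of_conjTranspose_mul_self hV, htr]
  simp only [Matrix.trace, Matrix.diag_apply, Complex.re_sum, Finset.mul_sum]
  refine Finset.sum_le_sum fun i _ => ?_
  have h0 := Complex.le_def.mp (hpos.diag_nonneg (i := i))
  have him : (τ i i).im = 0 := h0.2.symm
  have hre : 0 ≤ (τ i i).re := h0.1
  have h2 : (Matrix.diagonal e * τ * (Matrix.diagonal e)ᴴ) i i = (‖e i‖ ^ 2 : ℝ) * τ i i := by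
    rw [Matrix.diagonal_conjTranspose, Matrix.mul_diagonal, Matrix.diagonal_mul, mul_right_comm,
      Pi.star_apply, Complex.star_def, Complex.mul_conj, Complex.normSq_eq_norm_sq]
  rw [h2, Complex.re_ofReal_mul]
  gcongr
  exact he i

/-- A hybrid argument using positivity only: the later queries are replaced by induction, then the
current `Q = Q' + Δ` by `Q'`. No trace norm is needed. -/
theorem QueryProc.acceptWeight_le_add {N d T : ℕ} (proc : QueryProc N d T) (U : UGroup N)
    {δ δ' : Fin N → Circle} {ε : ℝ} (hε : 0 < ε) (hε1 : ε ≤ 1)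
    (h : ∀ j, ‖(δ j : ℂ) - δ' j‖ ≤ ε) {ρ : Op N d} (hρ : ρ.PosSemidef) :
    proc.acceptWeight (U * diagUnitary δ * U⁻¹) ρ ≤
      proc.acceptWeight (U * diagUnitary δ' * U⁻¹) ρ + 3 * T * ε * ρ.trace.re := by
  induction proc generalizing ρ with
  | @halt T E h0 h1 =>
    have : 0 ≤ ρ.trace.re := (Complex.le_def.mp hρ.trace_nonneg).1
    simp only [acceptWeight, le_add_iff_nonneg_right]
    positivity
  | @query T m K hK adj ctl next ih =>
    rw [← sum_trace_kraus hK ρ, Complex.re_sum, Finset.mul_sum]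
    simp only [acceptWeight]
    rw [← Finset.sum_add_distrib]
    refine Finset.sum_le_sum fun i _ => ?_
    set σ := K i * ρ * (K i)ᴴ
    have hσ : σ.PosSemidef := hρ.mul_mul_conjTranspose_same (K i)
    have hσt : 0 ≤ σ.trace.re := (Complex.le_def.mp hσ.trace_nonneg).1
    set X' := U * diagUnitary δ' * U⁻¹
    set Q := queryOp (U * diagUnitary δ * U⁻¹) (adj i) (ctl i) with hQ
    set Q' := queryOp X' (adj i) (ctl i) with hQ'
    set Δ := Q - Q' with hΔ
    have hΔ' : Δ = queryOp U false (fun _ => true) *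
        Matrix.diagonal (fun p => queryEigenvalue δ (adj i) (ctl i) p -
          queryEigenvalue δ' (adj i) (ctl i) p) * (queryOp U false fun _ : Fin d => true)ᴴ := by
      rw [hΔ, hQ, hQ', queryOp_conj_diagUnitary, queryOp_conj_diagUnitary, ← sub_mul, ← mul_sub,
        Matrix.diagonal_sub]
    have hΔt : (Δ * σ * Δᴴ).trace.re ≤ ε ^ 2 * σ.trace.re := by
      rw [hΔ']
      exact trace_conj_diagonal_le (queryOp_conjTranspose_mul_self _ _ _)
        (norm_queryEigenvalue_sub_le hε.le h (adj i) (ctl i)) hσ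
    have s1 := ih i (hσ.mul_mul_conjTranspose_same Q)
    rw [trace_conj_of_conjTranspose_mul_self (queryOp_conjTranspose_mul_self _ _ _)] at s1
    -- Weighted AM–GM for the cross terms: positivity of this conjugate of `σ` gives `ε QσQ† ≤
    -- ε(1+ε) Q'σQ'† + (1+ε) ΔσΔ†`. The two errors contribute, after division by `ε`, at most `ε +
    -- (1+ε)ε ≤ 3ε` times the trace.
    have s2 := acceptWeight_nonneg X' (next i)
      (hσ.mul_mul_conjTranspose_same (ε • Q' - Δ))
    have s3 := acceptWeight_le_trace X' (next i) (hσ.mul_mul_conjTranspose_same Δ)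
    have s4 := acceptWeight_le_trace X' (next i) (hσ.mul_mul_conjTranspose_same Q')
    rw [trace_conj_of_conjTranspose_mul_self (queryOp_conjTranspose_mul_self _ _ _)] at s4
    have s5 : (ε • Q' - Δ) * σ * (ε • Q' - Δ)ᴴ + ε • (Q * σ * Qᴴ) =
        (ε * (1 + ε)) • (Q' * σ * Q'ᴴ) + (1 + ε) • (Δ * σ * Δᴴ) := by
      have : Q = Q' + Δ := by rw [hΔ]; abel
      rw [this]
      simp only [Matrix.conjTranspose_sub, Matrix.conjTranspose_add, Matrix.conjTranspose_smul,
        mul_sub, sub_mul, mul_add, add_mul, Matrix.smul_mul, Matrix.mul_smul, star_trivial]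
      module
    have s6 := congrArg ((next i).acceptWeight X') s5
    simp only [acceptWeight_add, acceptWeight_smul] at s6
    set a := (next i).acceptWeight X' (Q * σ * Qᴴ)
    set b := (next i).acceptWeight X' (Q' * σ * Q'ᴴ)
    set c := (next i).acceptWeight X' (Δ * σ * Δᴴ)
    have s7 : ε * a ≤ ε * (b + 3 * ε * σ.trace.re) := by
      have t1 : (1 + ε) * c ≤ (1 + ε) * (ε ^ 2 * σ.trace.re) :=
        mul_le_mul_of_nonneg_left (s3.trans hΔt) (by linarith)
      have t2 : ε ^ 2 * b ≤ ε ^ 2 * σ.trace.re := mul_le_mul_of_nonneg_left s4 (by positivity)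
      have t3 : ε * (ε ^ 2 * σ.trace.re) ≤ 1 * (ε ^ 2 * σ.trace.re) :=
        mul_le_mul_of_nonneg_right hε1 (by positivity)
      linarith
    have s8 := le_of_mul_le_mul_left s7 hε
    push_cast
    linarith

theorem abs_acceptProb_sub_le {N T : ℕ} (A : QueryAlgorithm N T) (U : UGroup N)
    {δ δ' : Fin N → Circle} {ε : ℝ} (hε : 0 ≤ ε) (hε1 : ε ≤ 1)
    (h : ∀ j, ‖(δ j : ℂ) - δ' j‖ ≤ ε) :
    |A.acceptProb (U * diagUnitary δ * U⁻¹) - A.acceptProb (U * diagUnitary δ' * U⁻¹)| ≤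
      3 * T * ε := by
  rcases hε.eq_or_lt with rfl | hε
  -- The AM–GM step divides by `ε`, so `ε = 0` is treated apart.
  · have : δ = δ' := funext fun j => Circle.ext (sub_eq_zero.mp (norm_le_zero_iff.mp (h j)))
    simp [this]
  have h1 := A.proc.acceptWeight_le_add U hε hε1 h A.init_nonneg
  have h2 := A.proc.acceptWeight_le_add U hε hε1 (δ := δ') (δ' := δ)
    (fun j => by rw [norm_sub_rev]; exact h j) A.init_nonneg
  rw [A.init_trace, Complex.one_re, mul_one] at h1 h2
  rw [abs_sub_le_iff]
  constructor <;> simp only [QueryAlgorithm.acceptProb] <;> linarith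

theorem acceptProb_mem_Icc {N T : ℕ} (A : QueryAlgorithm N T) (X : UGroup N) :
    A.acceptProb X ∈ Set.Icc (0 : ℝ) 1 := by
  refine ⟨A.proc.acceptWeight_nonneg X A.init_nonneg, ?_⟩
  have := A.proc.acceptWeight_le_trace X A.init_nonneg
  rwa [A.init_trace, Complex.one_re] at this

theorem abs_conjAvg_sub_le {N T : ℕ} (A : QueryAlgorithm N T) {D D' : UGroup N} {B : ℝ}
    (h : ∀ U : UGroup N, |A.acceptProb (U * D * U⁻¹) - A.acceptProb (U * D' * U⁻¹)| ≤ B) :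
    |conjAvg A.acceptProb D - conjAvg A.acceptProb D'| ≤ B := by
  unfold conjAvg
  rw [← integral_sub (integrable_acceptProb_conj A D) (integrable_acceptProb_conj A D')]
  have h' : ∀ U : UGroup N,
      ‖A.acceptProb (U * D * U⁻¹) - A.acceptProb (U * D' * U⁻¹)‖ ≤ B := h
  have := norm_integral_le_of_norm_le_const (μ := haarUnitary N) (Filter.Eventually.of_forall h')
  simpa using this

/-! ### Newton's identities -/

/-- `b` is the sequence of coefficients attached by Newton's identities to the power sums `p`,
up to index `T`. -/
def IsNewtonSeq (T : ℕ) (b p : ℕ → ℂ) : Prop :=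
  b 0 = 1 ∧ ∀ k ≤ T, (k : ℂ) * b k = -∑ i ∈ Finset.range k, b i * p (k - i)

/-- The sequence of coefficients determined by the power sums `p` through Newton's identities. -/
noncomputable def newtonSeq (p : ℕ → ℂ) : ℕ → ℂ
  | 0 => 1
  | k + 1 => -(∑ i : Fin (k + 1), newtonSeq p i * p (k + 1 - i)) / (k + 1)

theorem isNewtonSeq_newtonSeq (T : ℕ) (p : ℕ → ℂ) : IsNewtonSeq T (newtonSeq p) p := by
  refine ⟨by rw [newtonSeq], fun k _ => ?_⟩
  cases k with
  | zero => simp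
  | succ k =>
    rw [newtonSeq, ← Fin.sum_univ_eq_sum_range (fun i => newtonSeq p i * p (k + 1 - i))]
    have : (k : ℂ) + 1 ≠ 0 := by exact_mod_cast k.succ_ne_zero
    push_cast
    field_simp

/-- Inductively the earlier coefficients have norm at most `1`, so Newton's identity bounds `k * ‖b
k‖` by the sum of the `‖p i‖`. -/
theorem IsNewtonSeq.norm_le {T : ℕ} {b p : ℕ → ℂ} (h : IsNewtonSeq T b p) {s : ℝ}
    (hs : ∑ k ∈ Finset.Icc 1 T, ‖p k‖ ≤ s) (hs1 : s ≤ 1) {k : ℕ} (hk : 1 ≤ k) (hkT : k ≤ T) :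
    ‖b k‖ ≤ s := by
  have hs0 : 0 ≤ s := (Finset.sum_nonneg fun _ _ => norm_nonneg _).trans hs
  induction k using Nat.strong_induction_on with
  | _ k ih =>
    have hb (i : ℕ) (hi : i < k) : ‖b i‖ ≤ 1 := by
      rcases Nat.eq_zero_or_pos i with rfl | hi0
      · simp [h.1]
      · exact (ih i hi hi0 (by omega)).trans hs1
    have h1 : ‖(k : ℂ) * b k‖ ≤ s := by
      rw [h.2 k hkT, norm_neg]
      calc ‖∑ i ∈ Finset.range k, b i * p (k - i)‖
          ≤ ∑ i ∈ Finset.range k, ‖p (k - i)‖ := by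
            refine norm_sum_le_of_le _ fun i hi => ?_
            rw [norm_mul]
            exact mul_le_of_le_one_left (norm_nonneg _) (hb i (Finset.mem_range.mp hi))
        _ = ∑ i ∈ Finset.Icc 1 k, ‖p i‖ := by
            refine Finset.sum_nbij' (fun i => k - i) (fun i => k - i) ?_ ?_ ?_ ?_ ?_ <;>
              intro i hi <;> simp only [Finset.mem_range, Finset.mem_Icc] at * <;> omega
        _ ≤ ∑ i ∈ Finset.Icc 1 T, ‖p i‖ :=
            Finset.sum_le_sum_of_subset_of_nonneg (Finset.Icc_subset_Icc_right hkT)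
              fun _ _ _ => norm_nonneg _
        _ ≤ s := hs
    rw [norm_mul, Complex.norm_natCast] at h1
    have h2 : (1 : ℝ) ≤ k := by exact_mod_cast hk
    nlinarith [norm_nonneg (b k)]

/-- Since `b 0 = 1`, the `i = 0` term of Newton's identity is `p k` itself, so the recursion can
also be solved for the power sums. -/
theorem IsNewtonSeq.powerSum_unique {T : ℕ} {b b' p p' : ℕ → ℂ} (h : IsNewtonSeq T b p)
    (h' : IsNewtonSeq T b' p') (hb : ∀ k ≤ T, b k = b' k) {k : ℕ} (hk : 1 ≤ k) (hkT : k ≤ T) :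
    p k = p' k := by
  induction k using Nat.strong_induction_on with
  | _ k ih =>
    obtain ⟨k, rfl⟩ := Nat.exists_eq_add_of_le' hk
    have e := h.2 _ hkT
    have e' := h'.2 _ hkT
    rw [hb _ hkT, e', neg_inj, Finset.sum_range_succ', Finset.sum_range_succ', h.1, h'.1] at e
    have : ∑ i ∈ Finset.range k, b' (i + 1) * p' (k + 1 - (i + 1)) =
        ∑ i ∈ Finset.range k, b (i + 1) * p (k + 1 - (i + 1)) := by
      refine Finset.sum_congr rfl fun i hi => ?_
      have := Finset.mem_range.mp hi
      rw [hb (i + 1) (by omega), ih (k + 1 - (i + 1)) (by omega) (by omega) (by omega)]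
    rw [this] at e
    simpa using (add_left_cancel e).symm

/-- The coefficient of `X ^ (M - k)` in `∏ j, (X - z j)`. -/
noncomputable def signedEsymm {M : ℕ} (z : Fin M → ℂ) (k : ℕ) : ℂ :=
  (-1) ^ k * (Finset.univ.val.map z).esymm k

theorem isNewtonSeq_signedEsymm {M : ℕ} (T : ℕ) (z : Fin M → ℂ) :
    IsNewtonSeq T (signedEsymm z) fun k => ∑ j, z j ^ k := by
  refine ⟨by rw [signedEsymm, Finset.esymm_map_val]; simp, fun k _ => ?_⟩
  have h := congrArg (MvPolynomial.aeval z) (MvPolynomial.mul_esymm_eq_sum (Fin M) ℂ k)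
  simp only [map_mul, map_sum, map_pow, map_neg, map_one, map_natCast,
    MvPolynomial.aeval_esymm_eq_multiset_esymm, MvPolynomial.psum, MvPolynomial.aeval_X] at h
  rw [Finset.sum_filter, Finset.Nat.sum_antidiagonal_eq_sum_range_succ_mk,
    Finset.sum_range_succ] at h
  simp only [lt_self_iff_false, if_false, add_zero] at h
  have h2 : (-1 : ℂ) ^ k * (-1) ^ (k + 1) = -1 := by
    rw [pow_succ, ← mul_assoc, ← mul_pow]; simp
  rw [signedEsymm, mul_left_comm, h, ← mul_assoc, h2, neg_one_mul]
  congr 1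
  refine Finset.sum_congr rfl fun i hi => ?_
  rw [if_pos (Finset.mem_range.mp hi)]
  rfl

theorem signedEsymm_self {M : ℕ} (z : Fin M → Circle) :
    ‖signedEsymm (fun j => (z j : ℂ)) M‖ = 1 := by
  have : Finset.powersetCard M (Finset.univ : Finset (Fin M)) = {Finset.univ} := by
    simpa using Finset.powersetCard_self (Finset.univ : Finset (Fin M))
  rw [signedEsymm, Finset.esymm_map_val, this, Finset.sum_singleton, norm_mul, norm_prod]
  simp only [Circle.norm_coe, Finset.prod_const_one, norm_pow, norm_neg, norm_one, one_pow, mul_one]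

/-- Unimodular roots make a polynomial self-inversive: the product over a complement is the full
product times the conjugate of the product over the set. -/
theorem signedEsymm_sub {M : ℕ} (z : Fin M → Circle) {k : ℕ} (hk : k ≤ M) :
    signedEsymm (fun j => (z j : ℂ)) (M - k) =
      signedEsymm (fun j => (z j : ℂ)) M * star (signedEsymm (fun j => (z j : ℂ)) k) := by
  have : Finset.powersetCard M (Finset.univ : Finset (Fin M)) = {Finset.univ} := by
    simpa using Finset.powersetCard_self (Finset.univ : Finset (Fin M))
  simp only [signedEsymm, Finset.esymm_map_val, this, Finset.sum_singleton, star_mul', star_pow,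
    star_neg, star_one, star_sum, star_prod]
  have h1 : (-1 : ℂ) ^ M * (-1) ^ k = (-1) ^ (M - k) := by
    obtain ⟨l, rfl⟩ := Nat.exists_eq_add_of_le hk
    rw [Nat.add_sub_cancel_left, pow_add, mul_right_comm, ← mul_pow]; simp
  rw [mul_mul_mul_comm, h1]
  congr 1
  rw [Finset.mul_sum]
  refine Finset.sum_nbij' (fun s : Finset (Fin M) => sᶜ) (fun s => sᶜ) ?_ ?_ ?_ ?_ ?_
  · intro s hs
    simp only [Finset.mem_powersetCard_univ] at *
    rw [Finset.card_compl, hs, Fintype.card_fin]; omega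
  · intro s hs
    simp only [Finset.mem_powersetCard_univ] at *
    rw [Finset.card_compl, hs, Fintype.card_fin]
  · simp
  · simp
  · intro s _
    rw [← Finset.prod_mul_prod_compl sᶜ fun j => (z j : ℂ), compl_compl, mul_assoc, mul_left_comm,
      ← Finset.prod_mul_distrib, Finset.prod_eq_one (s := sᶜ), mul_one]
    intro j _
    rw [Complex.star_def, Complex.mul_conj, Circle.normSq_coe, Complex.ofReal_one]

/-- The first `T` power sums of points whose coefficients are prescribed. -/
theorem sum_pow_eq_of_signedEsymm_eq {M T : ℕ} {z : Fin M → ℂ} {b p : ℕ → ℂ}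
    (h : IsNewtonSeq T b p) (hz : ∀ k ≤ T, signedEsymm z k = b k) {k : ℕ} (hk : 1 ≤ k)
    (hkT : k ≤ T) : ∑ j, z j ^ k = p k :=
  (isNewtonSeq_signedEsymm T z).powerSum_unique h hz hk hkT

/-! ### Roots of self-inversive polynomials -/

/-- `G` has opposite signs at `jπ` and `(j+1)π`. At a zero `|cos φ| ≤ δ`, and Jordan's inequality
`|sin ψ| ≥ (2/π)|ψ|` locates it near the midpoint. -/
theorem exists_zero_near_of_abs_sub_two_cos_le {G : ℝ → ℝ} (hG : Continuous G) {δ : ℝ}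
    (hδ : δ < 1) (h : ∀ x, |G x - 2 * Real.cos x| ≤ 2 * δ) (j : ℕ) :
    ∃ φ, G φ = 0 ∧ |φ - (j * Real.pi + Real.pi / 2)| ≤ Real.pi / 2 * δ := by
  have hsq : ((-1 : ℝ) ^ j) * (-1) ^ j = 1 := by rw [← mul_pow]; simp
  have habs : |(-1 : ℝ) ^ j| = 1 := by simp
  have h' (x : ℝ) : |(-1) ^ j * G x - 2 * ((-1) ^ j * Real.cos x)| ≤ 2 * δ := by
    have : (-1) ^ j * G x - 2 * ((-1) ^ j * Real.cos x) =
      (-1) ^ j * (G x - 2 * Real.cos x) := by ring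
    rw [this, abs_mul, habs, one_mul]
    exact h x
  have hc0 : (-1) ^ j * Real.cos (j * Real.pi) = 1 := by rw [Real.cos_nat_mul_pi, hsq]
  have hc1 : (-1) ^ j * Real.cos (j * Real.pi + Real.pi) = -1 := by
    rw [Real.cos_add_pi, mul_neg, hc0]
  have hle : j * Real.pi ≤ j * Real.pi + Real.pi := by linarith [Real.pi_pos]
  have hcont : ContinuousOn (fun x => (-1 : ℝ) ^ j * G x)
      (Set.Icc (j * Real.pi) (j * Real.pi + Real.pi)) := by fun_prop
  have ha := h' (j * Real.pi)
  have hb := h' (j * Real.pi + Real.pi)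
  rw [hc0, abs_le] at ha
  rw [hc1, abs_le] at hb
  obtain ⟨φ, hφ, hφ0⟩ := intermediate_value_Icc' hle hcont
    (show (0 : ℝ) ∈ _ from ⟨by linarith, by linarith⟩)
  have hG0 : G φ = 0 := by
    rcases mul_eq_zero.mp hφ0 with h0 | h0
    · rw [h0, abs_zero] at habs; norm_num at habs
    · exact h0
  refine ⟨φ, hG0, ?_⟩
  set ψ := φ - (j * Real.pi + Real.pi / 2) with hψ
  have hψ1 : |ψ| ≤ Real.pi / 2 := by
    rw [abs_le]; constructor <;> rw [hψ] <;> linarith [hφ.1, hφ.2]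
  have hcos : |Real.cos φ| = |Real.sin ψ| := by
    have : φ = (ψ + Real.pi / 2) + j * Real.pi := by rw [hψ]; ring
    rw [this, Real.cos_add_nat_mul_pi, abs_mul, habs, one_mul, Real.cos_add_pi_div_two, abs_neg]
  have h1 := h φ
  rw [hG0, zero_sub, abs_neg, abs_mul, abs_two, hcos] at h1
  have h2 := Real.mul_abs_le_abs_sin hψ1
  have h3 : 2 / Real.pi * |ψ| ≤ δ := by linarith
  have hpi := Real.pi_pos
  calc |ψ| = Real.pi / 2 * (2 / Real.pi * |ψ|) := by field_simp
    _ ≤ Real.pi / 2 * δ := by gcongr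

theorem norm_circleExp_sub_le (a b : ℝ) :
    ‖(Circle.exp a : ℂ) - Circle.exp b‖ ≤ |a - b| := by
  have : (Circle.exp a : ℂ) - Circle.exp b =
      Circle.exp b * (Complex.exp (Complex.I * ((a - b : ℝ) : ℂ)) - 1) := by
    rw [Circle.coe_exp, Circle.coe_exp, mul_sub, ← Complex.exp_add, mul_one]
    congr 2
    push_cast
    ring
  rw [this, norm_mul, Circle.norm_coe, one_mul]
  exact Real.norm_exp_I_mul_ofReal_sub_one_le

theorem sum_circleExp_pow_eq_zero {M : ℕ} (c : ℝ) {k : ℕ} (hk : 1 ≤ k) (hkM : k < M) :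
    ∑ j : Fin M, (Circle.exp ((2 * (j * Real.pi) + c) / M) : ℂ) ^ k = 0 := by
  have hM : (M : ℂ) ≠ 0 := by exact_mod_cast (by omega : M ≠ 0)
  have hζ := Complex.isPrimitiveRoot_exp M (by omega)
  set ζ := Complex.exp (2 * Real.pi * Complex.I / M)
  have h1 (j : Fin M) : (Circle.exp ((2 * (j * Real.pi) + c) / M) : ℂ) ^ k =
      Complex.exp (c / M * Complex.I) ^ k * (ζ ^ k) ^ (j : ℕ) := by
    rw [← pow_mul, mul_comm k, pow_mul, ← mul_pow, ← Complex.exp_nat_mul, ← Complex.exp_add,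
      Circle.coe_exp]
    congr 2
    push_cast
    field_simp
    ring
  simp_rw [h1]
  rw [← Finset.mul_sum, Fin.sum_univ_eq_sum_range (fun j => (ζ ^ k) ^ j)]
  have h2 := geom_sum_mul (ζ ^ k) M
  rw [← pow_mul, mul_comm k, pow_mul, hζ.pow_eq_one, one_pow, sub_self] at h2
  have h3 : ζ ^ k - 1 ≠ 0 := sub_ne_zero.mpr (hζ.pow_ne_one_of_pos_of_lt (by omega) hkM)
  rw [(mul_eq_zero.mp h2).resolve_right h3, mul_zero]

/-- Vieta's formulas for a polynomial with prescribed distinct roots. -/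
theorem signedEsymm_eq_of_roots {M : ℕ} {β : ℕ → ℂ} (h0 : β 0 = 1) {z : Fin M → ℂ}
    (hz : Function.Injective z)
    (hroot : ∀ j, ∑ k ∈ Finset.range (M + 1), β k * z j ^ (M - k) = 0) {k : ℕ} (hk : k ≤ M) :
    signedEsymm z k = β k := by
  open Polynomial in
  set P : ℂ[X] := ∑ k ∈ Finset.range (M + 1), C (β k) * X ^ (M - k) with hP
  set R : ℂ[X] := ∏ j, (X - C (z j)) with hR
  have hcoeff {k : ℕ} (hk : k ≤ M) : P.coeff (M - k) = β k := by
    rw [hP, finsetSum_coeff, Finset.sum_eq_single k]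
    · simp
    · intro l hl hlk
      have := Finset.mem_range.mp hl
      rw [coeff_C_mul_X_pow, if_neg (by omega)]
    · intro hk'
      exact absurd (Finset.mem_range.mpr (by omega)) hk'
  have hRm : R.Monic := monic_prod_X_sub_C _ _
  have hRd : R.natDegree = M := by simp [hR]
  have hdeg : (P - R).degree < (Finset.univ : Finset (Fin M)).card := by
    rw [Finset.card_univ, Fintype.card_fin, Polynomial.degree_lt_iff_coeff_zero]
    intro m hm
    rw [coeff_sub]
    rcases hm.eq_or_lt with rfl | hm
    · have := hcoeff (Nat.zero_le M)
      rw [Nat.sub_zero, h0] at this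
      rw [this, ← hRd, hRm.coeff_natDegree, sub_self]
    · rw [coeff_eq_zero_of_natDegree_lt (by omega : R.natDegree < m), sub_zero, hP,
        finsetSum_coeff]
      refine Finset.sum_eq_zero fun l _ => ?_
      rw [coeff_C_mul_X_pow, if_neg (by omega)]
  have hPR : P = R := by
    refine Polynomial.eq_of_degree_sub_lt_of_eval_index_eq _ hz.injOn hdeg fun j _ => ?_
    rw [hP, hR, eval_finsetSum, eval_prod, Finset.prod_eq_zero (Finset.mem_univ j) (by simp)]
    simpa using hroot j
  have hV := Multiset.prod_X_sub_C_coeff (Finset.univ.val.map z) (k := M - k) (by simp)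
  rw [← hcoeff hk, hPR, signedEsymm, hR]
  have hc : Multiset.card (Finset.univ.val.map z) = M := by simp
  rw [hc, Multiset.map_map, Nat.sub_sub_self hk] at hV
  exact hV.symm

/-- A self-inversive polynomial with small middle coefficients has its roots on the unit circle,
close to equally spaced points. -/
theorem exists_roots_near_equally_spaced {M : ℕ} (hM : 0 < M) {β : ℕ → ℂ} (h0 : β 0 = 1)
    (hc : ‖β M‖ = 1) (hsym : ∀ k ≤ M, β (M - k) = β M * star (β k)) {δ : ℝ} (hδ : δ < 1)
    (hsum : ∑ k ∈ Finset.Ioo 0 M, ‖β k‖ ≤ 2 * δ) :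
    ∃ z w : Fin M → Circle, (∀ k ≤ M, signedEsymm (fun j => (z j : ℂ)) k = β k) ∧
      (∀ k, 1 ≤ k → k < M → ∑ j, (w j : ℂ) ^ k = 0) ∧
      ∀ j, ‖(z j : ℂ) - w j‖ ≤ Real.pi * δ / M := by
  have hMR : (0 : ℝ) < M := by exact_mod_cast hM
  have hMC : (M : ℂ) ≠ 0 := by exact_mod_cast hM.ne'
  have hpi := Real.pi_pos
  set γ : ℝ := (β M).arg
  have hγ : β M = Complex.exp (γ * Complex.I) := by
    have := Complex.norm_mul_exp_arg_mul_I (β M)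
    rw [hc, Complex.ofReal_one, one_mul] at this
    exact this.symm
  -- Put `x = exp(i(2φ+γ)/M)` in the polynomial and divide by `exp(i(φ+γ))`. The end terms become
  -- `exp(±iφ)`, and self-inversiveness makes the terms `k` and `M - k` conjugate, so `F` is real
  -- and close to `2 cos φ`.
  let t : ℕ → ℝ → ℂ := fun k φ =>
    β k * Complex.exp ((((M : ℂ) - k) * ((2 * φ + γ) / M) - φ - γ) * Complex.I)
  let F : ℝ → ℂ := fun φ => ∑ k ∈ Finset.range (M + 1), t k φ
  have hF0 (φ : ℝ) : t 0 φ = Complex.exp (φ * Complex.I) := by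
    simp only [t, h0, one_mul]
    congr 1
    push_cast
    field_simp
    ring
  have hFM (φ : ℝ) : t M φ = Complex.exp (-φ * Complex.I) := by
    simp only [t, hγ, ← Complex.exp_add]
    congr 1
    ring
  have hstar (φ : ℝ) : star (F φ) = F φ := by
    simp only [F, star_sum]
    rw [← Finset.sum_range_reflect (fun k => t k φ)]
    refine Finset.sum_congr rfl fun k hk => ?_
    have hk' : k ≤ M := Nat.lt_succ_iff.mp (Finset.mem_range.mp hk)
    have e1 : M + 1 - 1 - k = M - k := by omega
    simp only [t, e1, hsym k hk', star_mul', hγ, mul_assoc, mul_left_comm _ (star (β k))]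
    rw [mul_comm (star (β k)), mul_comm (star (β k)), ← Complex.exp_add, Complex.star_def,
      ← Complex.exp_conj]
    congr 2
    simp only [map_mul, map_sub, map_add, map_div₀, Complex.conj_I, Complex.conj_ofReal,
      map_natCast, map_ofNat, Nat.cast_sub hk']
    field_simp
    ring
  have hre (φ : ℝ) : ((F φ).re : ℂ) = F φ := Complex.conj_eq_iff_re.mp (hstar φ)
  have hsplit (φ : ℝ) : F φ = ((2 * Real.cos φ : ℝ) : ℂ) + ∑ k ∈ Finset.Ioo 0 M, t k φ := by
    have e : Finset.range (M + 1) = insert 0 (insert M (Finset.Ioo 0 M)) := by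
      ext k
      simp only [Finset.mem_range, Finset.mem_insert, Finset.mem_Ioo]
      omega
    simp only [F]
    rw [e, Finset.sum_insert (by simp [hM.ne]), Finset.sum_insert (by simp), hF0, hFM, ← add_assoc]
    congr 1
    push_cast
    rw [Complex.two_cos]
  have hbound (φ : ℝ) : |(F φ).re - 2 * Real.cos φ| ≤ 2 * δ := by
    have e : (((F φ).re - 2 * Real.cos φ : ℝ) : ℂ) = ∑ k ∈ Finset.Ioo 0 M, t k φ := by
      rw [Complex.ofReal_sub, hre, hsplit]; ring
    rw [← Real.norm_eq_abs, ← Complex.norm_real, e]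
    refine (norm_sum_le_of_le _ fun k _ => ?_).trans hsum
    simp only [t]
    rw [norm_mul]
    have : (((M : ℂ) - k) * ((2 * φ + γ) / M) - φ - γ) * Complex.I =
        ((((M : ℝ) - k) * ((2 * φ + γ) / M) - φ - γ : ℝ) : ℂ) * Complex.I := by push_cast; ring
    rw [this, Complex.norm_exp_ofReal_mul_I, mul_one]
  have hcont : Continuous fun φ => (F φ).re := by
    simp only [F, t]
    fun_prop
  choose φ hφ0 hφ using exists_zero_near_of_abs_sub_two_cos_le hcont hδ hbound
  -- The points `w` correspond to `φ = jπ + π/2`, the zeros of the cosine; they are the roots of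
  -- `x^M + β M`.
  refine ⟨fun j => Circle.exp ((2 * φ j + γ) / M),
    fun j => Circle.exp ((2 * (j * Real.pi) + (Real.pi + γ)) / M), ?_, ?_, ?_⟩
  · intro k hk
    refine signedEsymm_eq_of_roots h0 ?_ (fun j => ?_) hk
    -- If two points coincide, `φ j - φ l = nMπ`. Each `φ` is less than `π/2` from its grid point,
    -- so the integer `j - l - nM` vanishes, and `0 ≤ j, l < M` gives `j = l`.
    · intro j l hjl
      obtain ⟨n, hn⟩ := Circle.exp_eq_exp.mp (Circle.ext hjl)
      have h1 : φ j - φ l = n * M * Real.pi := by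
        field_simp at hn
        linarith
      have h2 := hφ j
      have h3 := hφ l
      rw [abs_le] at h2 h3
      have h4 : Real.pi * δ < Real.pi := by nlinarith
      have h5 : |(((j : ℕ) - (l : ℕ) - n * M : ℤ) : ℝ)| < 1 := by
        push_cast
        rw [abs_lt]
        constructor <;> refine lt_of_mul_lt_mul_right ?_ hpi.le <;> nlinarith
      have h6 : ((j : ℕ) : ℤ) - (l : ℕ) - n * M = 0 := by
        rw [← Int.cast_abs] at h5
        exact Int.abs_lt_one_iff.mp (by exact_mod_cast h5)
      have h7 : ((j : ℕ) : ℤ) = (l : ℕ) := by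
        have hj : ((j : ℕ) : ℤ) < M := by exact_mod_cast j.2
        have hl : ((l : ℕ) : ℤ) < M := by exact_mod_cast l.2
        refine sub_eq_zero.mp (Int.eq_zero_of_abs_lt_dvd (m := M) ⟨n, ?_⟩ ?_)
        · linarith
        · rw [abs_lt]; constructor <;> omega
      exact Fin.ext (by exact_mod_cast h7)
    · have hz : F (φ j) = 0 := by rw [← hre, hφ0, Complex.ofReal_zero]
      have e : ∑ k ∈ Finset.range (M + 1),
          β k * (Circle.exp ((2 * φ j + γ) / M) : ℂ) ^ (M - k) =
          Complex.exp ((φ j + γ) * Complex.I) * F (φ j) := by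
        simp only [F, t, Finset.mul_sum]
        refine Finset.sum_congr rfl fun k hk => ?_
        have hk' : k ≤ M := Nat.lt_succ_iff.mp (Finset.mem_range.mp hk)
        rw [mul_left_comm, ← Complex.exp_add, Circle.coe_exp, ← Complex.exp_nat_mul,
          Nat.cast_sub hk']
        congr 2
        push_cast
        ring
      rw [e, hz, mul_zero]
  · intro k hk hkM
    exact sum_circleExp_pow_eq_zero _ hk hkM
  · intro j
    refine (norm_circleExp_sub_le _ _).trans ?_
    have e : (2 * φ j + γ) / M - (2 * (j * Real.pi) + (Real.pi + γ)) / M =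
        (2 * (φ j - (j * Real.pi + Real.pi / 2))) / M := by ring
    rw [e, abs_div, abs_mul, abs_two, Nat.abs_cast]
    refine div_le_div_of_nonneg_right ?_ hMR.le
    linarith [hφ j]

/-! ### Configurations with prescribed moments near moment-free ones -/

/-- There are `N` points on the circle with normalized moments `α 1, …, α T` at distance at most `η`
from `N` points whose first `T` moments vanish. -/
def HasNearbyConfig (N T : ℕ) (α : ℕ → ℂ) (η : ℝ) : Prop :=
  ∃ z w : Fin N → Circle, (∀ k, 1 ≤ k → k ≤ T → ∑ j, (z j : ℂ) ^ k = N * α k) ∧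
    (∀ k, 1 ≤ k → k ≤ T → ∑ j, (w j : ℂ) ^ k = 0) ∧ ∀ j, ‖(z j : ℂ) - w j‖ ≤ η

/-- Concatenation adds power sums, and blocks with equal normalized moments `α` again have
normalized moments `α`. -/
theorem HasNearbyConfig.add {m n T : ℕ} {α : ℕ → ℂ} {η : ℝ} (hm : HasNearbyConfig m T α η)
    (hn : HasNearbyConfig n T α η) : HasNearbyConfig (m + n) T α η := by
  obtain ⟨z, w, hz, hw, h⟩ := hm
  obtain ⟨z', w', hz', hw', h'⟩ := hn
  refine ⟨Fin.append z z', Fin.append w w', fun k hk hkT => ?_, fun k hk hkT => ?_, fun j => ?_⟩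
  · simp only [Fin.sum_univ_add, Fin.append_left, Fin.append_right, hz k hk hkT, hz' k hk hkT]
    push_cast
    ring
  · simp only [Fin.sum_univ_add, Fin.append_left, Fin.append_right, hw k hk hkT, hw' k hk hkT,
      add_zero]
  · refine Fin.addCases (fun i => ?_) (fun i => ?_) j
    · simpa using h i
    · simpa using h' i

theorem hasNearbyConfig_of_two_mul_lt {M T : ℕ} (hT : 1 ≤ T) (hM : 2 * T < M) (α : ℕ → ℂ) {s : ℝ}
    (hs : ∑ k ∈ Finset.Icc 1 T, ‖α k‖ ≤ s) (hs1 : M * T * s < 1) :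
    HasNearbyConfig M T α (Real.pi * T * s) := by
  have hs0 : 0 ≤ s := (Finset.sum_nonneg fun _ _ => norm_nonneg _).trans hs
  have hMR : (0 : ℝ) < M := by exact_mod_cast (by omega : 0 < M)
  have hTR : (1 : ℝ) ≤ T := by exact_mod_cast hT
  set b := newtonSeq fun k => M * α k
  have hb : IsNewtonSeq T b fun k => M * α k := isNewtonSeq_newtonSeq T _
  have hps : ∑ k ∈ Finset.Icc 1 T, ‖(M : ℂ) * α k‖ ≤ M * s := by
    simp_rw [norm_mul, Complex.norm_natCast, ← Finset.mul_sum]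
    gcongr
  have hMs : M * s ≤ 1 := by nlinarith [mul_nonneg hMR.le hs0]
  have hbs {k : ℕ} (hk : 1 ≤ k) (hkT : k ≤ T) : ‖b k‖ ≤ M * s := hb.norm_le hps hMs hk hkT
  -- The first `T` coefficients come from Newton's identities and are reflected at the other end,
  -- with zeros between; `2 * T < M` keeps the two ends apart. At most `2T` middle coefficients,
  -- each of size at most `M s`, give `δ = M T s`.
  let β : ℕ → ℂ := fun k => if k ≤ T then b k else if M - k ≤ T then star (b (M - k)) else 0
  have hβ {k : ℕ} (hk : k ≤ T) : β k = b k := if_pos hk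
  have hβM : β M = 1 := by
    simp only [β]
    rw [if_neg (by omega), if_pos (by omega), Nat.sub_self, hb.1, star_one]
  obtain ⟨z, w, hz, hw, h⟩ := exists_roots_near_equally_spaced (M := M) (by omega) (β := β)
    (δ := M * T * s) (by rw [hβ (Nat.zero_le T), hb.1]) (by rw [hβM, norm_one])
    (fun k hk => by
      rw [hβM, one_mul]
      simp only [β]
      rcases le_or_gt k T with h1 | h1
      · rw [if_neg (by omega), if_pos (by omega), if_pos h1, Nat.sub_sub_self hk]
      · rcases le_or_gt (M - k) T with h2 | h2
        · rw [if_pos h2, if_neg (by omega), if_pos h2, star_star]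
        · rw [if_neg (by omega), if_neg (by omega), if_neg (by omega), if_neg (by omega),
            star_zero])
    hs1 (by
      have hle : ∀ k ∈ Finset.Ioo 0 M, ‖β k‖ ≤
          (if k ∈ Finset.Icc 1 T then M * s else 0) +
            (if k ∈ Finset.Ico (M - T) M then M * s else 0) := by
        intro k hk
        rw [Finset.mem_Ioo] at hk
        simp only [β, Finset.mem_Icc, Finset.mem_Ico]
        rcases le_or_gt k T with h1 | h1
        · rw [if_pos h1, if_pos ⟨hk.1, h1⟩, if_neg (by omega), add_zero]
          exact hbs hk.1 h1
        · rcases le_or_gt (M - k) T with h2 | h2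
          · rw [if_neg (by omega), if_pos h2, if_neg (by omega), if_pos (by omega), zero_add,
              norm_star]
            exact hbs (by omega) h2
          · rw [if_neg (by omega), if_neg (by omega), if_neg (by omega), if_neg (by omega)]
            simp
      refine (Finset.sum_le_sum hle).trans ?_
      rw [Finset.sum_add_distrib, Finset.sum_ite_mem, Finset.sum_ite_mem, Finset.sum_const,
        Finset.sum_const, nsmul_eq_mul, nsmul_eq_mul, ← add_mul]
      have c1 : (Finset.Ioo 0 M ∩ Finset.Icc 1 T).card ≤ T :=
        (Finset.card_le_card Finset.inter_subset_right).trans (by simp)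
      have c2 : (Finset.Ioo 0 M ∩ Finset.Ico (M - T) M).card ≤ T :=
        (Finset.card_le_card Finset.inter_subset_right).trans (by rw [Nat.card_Ico]; omega)
      have c3 : ((Finset.Ioo 0 M ∩ Finset.Icc 1 T).card +
          (Finset.Ioo 0 M ∩ Finset.Ico (M - T) M).card : ℝ) ≤ 2 * T := by
        exact_mod_cast (by omega : (Finset.Ioo 0 M ∩ Finset.Icc 1 T).card +
          (Finset.Ioo 0 M ∩ Finset.Ico (M - T) M).card ≤ 2 * T)
      refine (mul_le_mul_of_nonneg_right c3 (by positivity)).trans_eq ?_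
      ring)
  refine ⟨z, w, fun k hk hkT => ?_, fun k hk hkT => hw k hk (by omega), fun j => ?_⟩
  · exact sum_pow_eq_of_signedEsymm_eq (z := fun j => (z j : ℂ)) hb
      (fun l hl => by rw [hz l (by omega), hβ hl]) hk hkT
  · refine (h j).trans_eq ?_
    field_simp

/-- Here there is no room for free coefficients, so the polynomial with roots `y` is used. Beyond
index `T` its coefficients are small by reflection, since `N - k ≤ T` there. -/
theorem hasNearbyConfig_of_le_two_mul {N T : ℕ} (hTN : T < N) (hN : N ≤ 2 * T) (y : Fin N → Circle)
    {α : ℕ → ℂ} (hα : ∀ k, 1 ≤ k → k ≤ T → ∑ j, (y j : ℂ) ^ k = N * α k) {s : ℝ}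
    (hs : ∑ k ∈ Finset.Icc 1 T, ‖α k‖ ≤ s) (hs1 : N * T * s < 1) :
    HasNearbyConfig N T α (Real.pi * T * s) := by
  have hs0 : 0 ≤ s := (Finset.sum_nonneg fun _ _ => norm_nonneg _).trans hs
  have hNR : (0 : ℝ) < N := by exact_mod_cast (by omega : 0 < N)
  have hTR : (1 : ℝ) ≤ T := by exact_mod_cast (by omega : 1 ≤ T)
  set b := signedEsymm fun j => (y j : ℂ)
  have hb : IsNewtonSeq T b fun k => ∑ j, (y j : ℂ) ^ k := isNewtonSeq_signedEsymm T _
  have hps : ∑ k ∈ Finset.Icc 1 T, ‖∑ j, (y j : ℂ) ^ k‖ ≤ N * s := by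
    calc _ = ∑ k ∈ Finset.Icc 1 T, N * ‖α k‖ := by
          refine Finset.sum_congr rfl fun k hk => ?_
          rw [Finset.mem_Icc] at hk
          rw [hα k hk.1 hk.2, norm_mul, Complex.norm_natCast]
      _ ≤ N * s := by rw [← Finset.mul_sum]; gcongr
  have hNs : N * s ≤ 1 := by nlinarith [mul_nonneg hNR.le hs0]
  have hbs {k : ℕ} (hk : 1 ≤ k) (hkT : k ≤ T) : ‖b k‖ ≤ N * s := hb.norm_le hps hNs hk hkT
  have hbN : ‖b N‖ = 1 := signedEsymm_self y
  have hsym : ∀ k ≤ N, b (N - k) = b N * star (b k) := fun k hk => signedEsymm_sub y hk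
  obtain ⟨z, w, hz, hw, h⟩ := exists_roots_near_equally_spaced (M := N) (by omega) (β := b)
    (δ := N * T * s) hb.1 hbN hsym hs1 (by
      have hle : ∀ k ∈ Finset.Ioo 0 N, ‖b k‖ ≤ N * s := by
        intro k hk
        rw [Finset.mem_Ioo] at hk
        rcases le_or_gt k T with h1 | h1
        · exact hbs hk.1 h1
        · have := hsym (N - k) (by omega)
          rw [Nat.sub_sub_self hk.2.le] at this
          rw [this, norm_mul, hbN, one_mul, norm_star]
          exact hbs (by omega) (by omega)
      refine (Finset.sum_le_card_nsmul _ _ _ hle).trans ?_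
      rw [Nat.card_Ioo, nsmul_eq_mul]
      have : ((N - 0 - 1 : ℕ) : ℝ) ≤ 2 * T := by exact_mod_cast (by omega : N - 0 - 1 ≤ 2 * T)
      refine (mul_le_mul_of_nonneg_right this (by positivity)).trans_eq ?_
      ring)
  refine ⟨z, w, fun k hk hkT => ?_, fun k hk hkT => hw k hk (by omega), fun j => ?_⟩
  · rw [← hα k hk hkT]
    exact sum_pow_eq_of_signedEsymm_eq (z := fun j => (z j : ℂ)) hb
      (fun l hl => hz l (by omega)) hk hkT
  · refine (h j).trans_eq ?_
    field_simp

/-- Blocks of size `2T + 1` are split off until at most `4T + 1` points remain. Every block has size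
at most `5T`, whence a smallness condition free of `N`. -/
theorem exists_hasNearbyConfig {N T : ℕ} (hT : 1 ≤ T) (hTN : T < N) (y : Fin N → Circle)
    {α : ℕ → ℂ} (hα : ∀ k, 1 ≤ k → k ≤ T → ∑ j, (y j : ℂ) ^ k = N * α k) {s : ℝ}
    (hs : ∑ k ∈ Finset.Icc 1 T, ‖α k‖ ≤ s) (hs1 : 5 * T ^ 2 * s < 1) :
    HasNearbyConfig N T α (Real.pi * T * s) := by
  have hs0 : 0 ≤ s := (Finset.sum_nonneg fun _ _ => norm_nonneg _).trans hs
  have hlt {M : ℕ} (hM : M ≤ 4 * T + 1) : M * T * s < 1 := by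
    have : (M : ℝ) ≤ 5 * T := by exact_mod_cast (by omega : M ≤ 5 * T)
    refine lt_of_le_of_lt ?_ hs1
    have h1 : (M : ℝ) * T * s ≤ (5 * T) * T * s := by gcongr
    linarith
  rcases le_or_gt N (2 * T) with hN | hN
  · exact hasNearbyConfig_of_le_two_mul hTN hN y hα hs (hlt (by omega))
  -- Above `2T` points the construction uses only `α`, which need not come from given points once
  -- `N` has been lowered.
  clear hα y hTN
  induction N using Nat.strong_induction_on with
  | _ N ih =>
    rcases le_or_gt N (4 * T + 1) with h4 | h4
    · exact hasNearbyConfig_of_two_mul_lt hT hN α hs (hlt h4)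
    · have h1 := ih (N - (2 * T + 1)) (by omega) (by omega)
      have h2 := hasNearbyConfig_of_two_mul_lt hT (M := 2 * T + 1) (by omega) α hs
        (hlt (by omega))
      have := h1.add h2
      rwa [Nat.sub_add_cancel (by omega)] at this

/-- Turán's power sum bound: the first `N` power sums of `N` unimodular numbers cannot all be
small. -/
theorem one_le_sum_norm_powerSum {N T : ℕ} (hN : 1 ≤ N) (hNT : N ≤ T) (y : Fin N → Circle) :
    1 ≤ ∑ k ∈ Finset.Icc 1 T, ‖∑ j, (y j : ℂ) ^ k‖ := by
  by_contra! hlt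
  -- If the sum were below `1`, so would be the norm of the `N`-th coefficient, which is a product
  -- of unimodular numbers up to sign.
  have h := (isNewtonSeq_signedEsymm T fun j => (y j : ℂ)).norm_le le_rfl hlt.le hN hNT
  rw [signedEsymm_self] at h
  linarith

/-! ### Assembling the final estimate -/

theorem momentNorm_nonneg {N : ℕ} (X : UGroup N) (T : ℕ) : 0 ≤ momentNorm X T :=
  Finset.sum_nonneg fun _ _ => norm_nonneg _

theorem sum_pow_eq_mul_traceMoment {N : ℕ} (hN : 1 ≤ N) (δ : Fin N → Circle) (k : ℕ) :
    ∑ j, (δ j : ℂ) ^ k = N * traceMoment (diagUnitary δ) k := by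
  rw [traceMoment_diagUnitary, mul_div_cancel₀]
  exact_mod_cast (by omega : N ≠ 0)

theorem one_le_mul_momentNorm {N T : ℕ} (hN : 1 ≤ N) (hNT : N ≤ T) (y : Fin N → Circle) :
    1 ≤ N * momentNorm (diagUnitary y) T := by
  have := one_le_sum_norm_powerSum hN hNT y
  simp_rw [sum_pow_eq_mul_traceMoment hN, norm_mul, Complex.norm_natCast, ← Finset.mul_sum] at this
  exact this

theorem abs_conjAvg_acceptProb_sub_le {N T : ℕ} (A : QueryAlgorithm N T) (y ζ : Fin N → Circle)
    (hζ : ∀ k : ℕ, 1 ≤ k → k ≤ T → k < N → traceMoment (diagUnitary ζ) k = 0) :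
    |conjAvg A.acceptProb (diagUnitary y) - conjAvg A.acceptProb (diagUnitary ζ)| ≤
      16 * momentNorm (diagUnitary y) T * (T : ℝ) ^ (7 / 2 : ℝ) := by
  set s := momentNorm (diagUnitary y) T with hs
  have hs0 : 0 ≤ s := momentNorm_nonneg _ _
  have htriv (h : ∀ k, 1 ≤ k → k ≤ T → ∑ j, (y j : ℂ) ^ k = ∑ j, (ζ j : ℂ) ^ k) :
      |conjAvg A.acceptProb (diagUnitary y) - conjAvg A.acceptProb (diagUnitary ζ)| ≤
        16 * s * (T : ℝ) ^ (7 / 2 : ℝ) := by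
    rw [conjAvg_acceptProb_eq A h, sub_self, abs_zero]
    positivity
  rcases Nat.eq_zero_or_pos T with hT | hT
  · exact htriv fun k hk hkT => by omega
  rcases Nat.eq_zero_or_pos N with rfl | hN
  · exact htriv fun k _ _ => by simp
  have hTR : (1 : ℝ) ≤ T := by exact_mod_cast hT
  have hpow : (T : ℝ) ^ 2 ≤ (T : ℝ) ^ (7 / 2 : ℝ) := by
    rw [← Real.rpow_natCast]
    exact Real.rpow_le_rpow_of_exponent_le hTR (by norm_num)
  rcases le_or_gt 1 (16 * s * (T : ℝ) ^ (7 / 2 : ℝ)) with hbig | hsmall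
  · refine (abs_conjAvg_sub_le A fun U => ?_).trans hbig
    have h1 := acceptProb_mem_Icc A (U * diagUnitary y * U⁻¹)
    have h2 := acceptProb_mem_Icc A (U * diagUnitary ζ * U⁻¹)
    rw [abs_sub_le_iff]
    constructor <;> linarith [h1.1, h1.2, h2.1, h2.2]
  have hsT : 16 * (T : ℝ) ^ 2 * s < 1 := by
    have : s * (T : ℝ) ^ 2 ≤ s * (T : ℝ) ^ (7 / 2 : ℝ) := by gcongr
    linarith
  -- If `N ≤ T`, Turán's bound gives `1 ≤ N s ≤ T² s`, against `hsT`. With `T < N` the restriction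
  -- `k < N` on the vanishing moments is void.
  have hTN : T < N := by
    by_contra! hNT
    have h1 := one_le_mul_momentNorm hN hNT y
    have h2 : (N : ℝ) ≤ T := by exact_mod_cast hNT
    have h3 : (N : ℝ) * s ≤ T * s := by gcongr
    have h4 : (T : ℝ) * s ≤ T ^ 2 * s := by gcongr; nlinarith
    linarith
  have hTs : 0 ≤ (T : ℝ) ^ 2 * s := by positivity
  obtain ⟨z, w, hz, hw, h⟩ := exists_hasNearbyConfig hT hTN y (s := s)
    (fun k _ _ => sum_pow_eq_mul_traceMoment hN y k) le_rfl (by linarith)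
  have hy : conjAvg A.acceptProb (diagUnitary y) = conjAvg A.acceptProb (diagUnitary z) :=
    conjAvg_acceptProb_eq A fun k hk hkT => by
      rw [hz k hk hkT, sum_pow_eq_mul_traceMoment hN]
  have hζ' : conjAvg A.acceptProb (diagUnitary ζ) = conjAvg A.acceptProb (diagUnitary w) :=
    conjAvg_acceptProb_eq A fun k hk hkT => by
      rw [hw k hk hkT, sum_pow_eq_mul_traceMoment hN, hζ k hk hkT (by omega), mul_zero]
  rw [hy, hζ']
  have hpi := Real.pi_lt_d2
  have hε : Real.pi * T * s ≤ 1 := by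
    have h4 : (T : ℝ) * s ≤ T ^ 2 * s := by gcongr; nlinarith
    have h5 : Real.pi * (T * s) ≤ 3.15 * (T * s) := by gcongr
    nlinarith
  refine (abs_conjAvg_sub_le A fun U => abs_acceptProb_sub_le A U (by positivity) hε h).trans ?_
  -- `3T` is the hybrid cost and `π T s` the eigenvalue shift; `3π < 16` and `T² ≤ T^(7/2)`.
  calc 3 * T * (Real.pi * T * s) = (3 * Real.pi) * s * (T : ℝ) ^ 2 := by ring
    _ ≤ 16 * s * (T : ℝ) ^ (7 / 2 : ℝ) := by gcongr; linarith

theorem mainTheorem10 {N T : ℕ} (Z Y : UGroup N)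
    (hZ : (Z : Matrix (Fin N) (Fin N) ℂ).IsDiag)
    (hY : (Y : Matrix (Fin N) (Fin N) ℂ).IsDiag)
    (hZ_moments : ∀ k : ℕ, 1 ≤ k → k ≤ T → k < N → traceMoment Z k = 0)
    {Ω Ω' : Type*} [MeasurableSpace Ω] [MeasurableSpace Ω']
    (P : Measure Ω) [IsProbabilityMeasure P] (P' : Measure Ω') [IsProbabilityMeasure P']
    (M : Ω → UGroup N) (hM : HasLaw M (haarConjLaw Z) P)
    (W : Ω' → UGroup N) (hW : HasLaw W (haarConjLaw Y) P')
    (A : QueryAlgorithm N T) :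
    |(∫ ω, A.acceptProb (W ω) ∂P') - ∫ ω, A.acceptProb (M ω) ∂P| ≤
      16 * momentNorm Y T * (T : ℝ) ^ (7 / 2 : ℝ) := by
  obtain ⟨ζ, rfl⟩ := exists_eq_diagUnitary Z hZ
  obtain ⟨y, rfl⟩ := exists_eq_diagUnitary Y hY
  rw [integral_eq_conjAvg hM (continuous_acceptProb A),
    integral_eq_conjAvg hW (continuous_acceptProb A)]
  exact abs_conjAvg_acceptProb_sub_le A y ζ hZ_moments
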